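/- **Theorem 4.** Let $G=(V,E)$ be a hidden, connected, chordal graph (every cycle of length greater than three has a chord) with $n\ge 2$ vertices and maximum degree $\Delta$. Given $V$ and $\Delta$, and access to $G$ only through a distance oracle (a query $(u,v)$ returns the graph distance $\delta(u,v)$), the randomized algorithm below, called with $U=V$, halts with probability $1$ and outputs exactly $E$, and its expected number of queries is $$O\big(\Delta^3 2^{\Delta}\, n\,(2^{\Delta}+\log^2 n)\,\log n\big),$$ where the constant in $O(\cdot)$ is absolute. In particular, for every real $c$ there are $C$ and $k$ such that the expected number of queries is at most $C\,n\log^k n$ for all such graphs with $\Delta\le c\log\log n$; that is, it is $\tilde O(n)$ when $\Delta=O(\log\log n)$. *The algorithm.* Put $n_0=2^{\Delta+2}(\Delta+1)^2$, $C_1=256(\Delta+1)^2$ and $\beta=\max\big(1-\tfrac{1}{\Delta 2^{\Delta+1}},\sqrt{1-\tfrac1{4(\Delta+1)}}\big)$. Write $N(v)=\{u:\delta(u,v)\le 1\}$ and $N(S)=\bigcup_{s\in S}N(s)$. - Reconstruct-Chordal$(U)$: if $|U|\le n_0$, query all pairs in $U\times U$ and return the edges between vertices of $U$. Otherwise let $K=$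 Balanced-Separator$(U)$ and $(U_1,\dots,U_\ell)=$ Partition$(U,K)$, and return the union of the results of Reconstruct-Chordal$(U_i\cup K)$. - Balanced-Separator$(U)$ repeats the following until it returns. Choose $\lceil C_1\log|U|\rceil$ independent, uniformly random pairs $(a_i,b_i)\in U^2$ and compute $P_i=$ Shortest-Path$(U,a_i,b_i)$. Let $x\in U$ be a vertex that lies on the largest number of the $P_i$. Query $\{x\}\times U$ to get $N(x)\cap U$, and query all pairs of vertices of $N(x)\cap U$ to get all cliques $K\subseteq U$ with $x\in K$. For each such $K$ in turn, compute Partition$(U,K)=(U_1,\dots,U_\ell)$, and return $K$ if $\max_i|U_i|<\beta|U|$. - Partition$(U,S)$: query $S\times U$ and $(N(S)\cap U)\times U$. For $a\in (N(S)\cap U)\setminus S$ let $B(a)=\{x\in U\setminus S:\delta(a,x)\le\min_{s\in S}\delta(s,x)\}$. As long as two of these sets overlap, replace them by their union. Return the resulting sets. - Shortest-Path$(U,a,b)$: query $(a,b)$. If $\delta(a,b)\le1$, return the path $(a,b)$ (or $(a)$ if $a=b$). Otherwise query $\{a,b\}\times U$, let $T=\{v\in U:\delta(v,a)+\delta(v,b)=\delta(a,b)\}$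 and $\ell=\lfloor\delta(a,b)/2\rfloor$, choose $c\in T$ with $\delta(c,a)=\ell$, and return the concatenation of Shortest-Path$(\{v\in T:\delta(v,a)<\ell\},a,c)$ and Shortest-Path$(\{v\in T:\delta(v,a)>\ell\},c,b)$. -/

import Mathlib

open scoped ENNReal

/-- A graph is chordal if every cycle of length greater than three has a chord: an edge of the graph
between two vertices of the cycle that are not consecutive on it. -/
def SimpleGraph.IsChordal {V : Type} (G : SimpleGraph V) : Prop :=
  ∀ (v : V) (p : G.Walk v v), p.IsCycle → 3 < p.length →
    ∃ x ∈ p.support, ∃ y ∈ p.support, G.Adj x y ∧ s(x, y) ∉ p.edges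

/-- Randomized programs with access to a distance oracle on the vertex set `V`, and with a result of
type `α`. The only access to the hidden graph is the instruction `query`. -/
inductive OracleProg (V : Type) : Type → Type 1
  /-- halt with result `a` -/
  | pure {α : Type} (a : α) : OracleProg V α
  /-- run `p`, then continue with `k`, which sees the result of `p` -/
  | bind {α β : Type} (p : OracleProg V β) (k : β → OracleProg V α) : OracleProg V α
  /-- one query to the distance oracle -/
  | query (u v : V) : OracleProg V ℕ
  /-- a fresh, uniformly random element of a non-empty set of vertices -/
  | uniform (S : Finset V) (hS : S.Nonempty) : OracleProg V V
  /-- run `body` again and again, with fresh randomness, until a run of it has a result -/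
  | repeatUntil {α : Type} (body : OracleProg V (Option α)) : OracleProg V α

namespace OracleProg

instance (V : Type) : Monad (OracleProg V) where
  pure := OracleProg.pure
  bind := OracleProg.bind

/-- Given the expectation functional `E` of one round of a loop, the expectation of
`f (result) (number of queries)` over the runs of the loop that halt within the given number of
rounds. -/
noncomputable def loopExpect {α : Type} (E : (Option α → ℕ → ℝ≥0∞) → ℝ≥0∞) :
    ℕ → (α → ℕ → ℝ≥0∞) → ℝ≥0∞
  | 0, _ => 0
  | t + 1, f => E fun o q =>
      match o with
      | none => loopExpect E t fun a r => f a (q + r)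
      | some a => f a q

/-- The expectation of `f (result) (number of queries)` over the random runs of a program that
halt, when the oracle answers the query `(u, v)` by `δ u v`. -/
noncomputable def expect {V : Type} (δ : V → V → ℕ) :
    {α : Type} → OracleProg V α → (α → ℕ → ℝ≥0∞) → ℝ≥0∞
  | _, .pure a, f => f a 0
  | _, .bind p k, f => expect δ p fun b q => expect δ (k b) fun a r => f a (q + r)
  | _, .query u v, f => f (δ u v) 1
  | _, .uniform S _, f => (∑ s ∈ S, f s 0) / (S.card : ℝ≥0∞)
  | _, .repeatUntil body, f => ⨆ t : ℕ, loopExpect (fun g => expect δ body g) t f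

open Classical in
/-- The probability that a program halts with a result that satisfies `P`. -/
noncomputable def probability {V α : Type} (δ : V → V → ℕ) (p : OracleProg V α) (P : α → Prop) :
    ℝ≥0∞ :=
  p.expect δ fun a _ => if P a then 1 else 0

/-- The expected number of queries of a program that halts with probability one. -/
noncomputable def expectedQueries {V α : Type} (δ : V → V → ℕ) (p : OracleProg V α) : ℝ≥0∞ :=
  p.expect δ fun _ q => (q : ℝ≥0∞)

end OracleProg

namespace ChordalReconstruction

variable {V : Type} [DecidableEq V]

/-- Query all pairs in a list. The result is the table of the answers (0 for pairs not queried). -/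
def queryList : List (V × V) → OracleProg V (V → V → ℕ)
  | [] => pure fun _ _ => 0
  | (u, v) :: l => do
      let d ← OracleProg.query u v
      let table ← queryList l
      pure fun u' v' => if u' = u ∧ v' = v then d else table u' v'

/-- Query all pairs in `S × T`. -/
noncomputable def querySets (S T : Finset V) : OracleProg V (V → V → ℕ) :=
  queryList (S ×ˢ T).toList

open Classical in
/-- While the family has two members that overlap, merge two such members. -/
noncomputable def mergeClusters (F : Finset (Finset V)) : Finset (Finset V) :=
  if h : ∃ B : Finset V × Finset V,
      B.1 ∈ F ∧ B.2 ∈ F ∧ B.1 ≠ B.2 ∧ (B.1 ∩ B.2).Nonempty then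
    mergeClusters (insert (h.choose.1 ∪ h.choose.2) ((F.erase h.choose.1).erase h.choose.2))
  else F
termination_by F.card
decreasing_by
  obtain ⟨h1, h2, h3, -⟩ := h.choose_spec
  have e1 := Finset.card_erase_add_one h1
  have e2 := Finset.card_erase_add_one (Finset.mem_erase.2 ⟨h3.symm, h2⟩)
  have e3 := Finset.card_insert_le (h.choose.1 ∪ h.choose.2)
    ((F.erase h.choose.1).erase h.choose.2)
  omega

/-- `Partition(U, S)`: after querying `S × U` and `(N(S) ∩ U) × U`, form the clusters
`B(a) = {x ∈ U \ S | δ(a, x) ≤ δ(S, x)}` for `a ∈ (N(S) ∩ U) \ S`, and merge overlapping clusters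
(here `δ(S, x)` is the minimum of `δ(s, x)` over `s ∈ S`). -/
noncomputable def partition (U S : Finset V) : OracleProg V (Finset (Finset V)) := do
  let d ← querySets S U
  let N := U.filter fun v => ∃ s ∈ S, d s v ≤ 1
  let e ← querySets N U
  let cluster := fun a => (U \ S).filter fun x => ∀ s ∈ S, e a x ≤ d s x
  pure (mergeClusters ((N \ S).image cluster))

/-- `Shortest-Path(U, a, b)`: the list of the vertices of a shortest path from `a` to `b`, computed by
divide and conquer. (The branch that gives the empty list is reached only if no vertex of `U` lies at
distance `⌊δ(a, b) / 2⌋` from `a` on a shortest path to `b`.) -/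
noncomputable def shortestPath (U : Finset V) (a b : V) : OracleProg V (List V) := do
  let D ← OracleProg.query a b
  if 1 < D then
    let da ← querySets {a} U
    let db ← querySets {b} U
    let T := U.filter fun v => da a v + db b v = D
    if h : ∃ c ∈ T, da a c = D / 2 then
      let c := h.choose
      let P₁ ← shortestPath (T.filter fun v => da a v < D / 2) a c
      let P₂ ← shortestPath (T.filter fun v => D / 2 < da a v) c b
      pure (P₁ ++ P₂.tail)
    else pure []
  else if a = b then pure [a]
  else pure [a, b]
termination_by U.card
decreasing_by
  all_goals
    obtain ⟨h1, _⟩ := h.choose_spec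
    refine Finset.card_lt_card (Finset.ssubset_iff_of_subset
      ((Finset.filter_subset _ _).trans (Finset.filter_subset _ _)) |>.2
      ⟨h.choose, (Finset.mem_filter.1 h1).1, fun h3 => ?_⟩)
    have h4 := (Finset.mem_filter.1 h3).2
    omega

/-- The threshold `n₀` on the number of vertices below which all pairs are queried. -/
def threshold (Δ : ℕ) : ℕ := 2 ^ (Δ + 2) * (Δ + 1) ^ 2

/-- The balance constant `β`. -/
noncomputable def balance (Δ : ℕ) : ℝ :=
  max (1 - 1 / ((Δ : ℝ) * 2 ^ (Δ + 1))) (Real.sqrt (1 - 1 / (4 * ((Δ : ℝ) + 1))))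

/-- The number of shortest paths sampled in one round: `C₁ log |U|` with `C₁ = 256 (Δ + 1)²`, rounded
up to an integer. -/
noncomputable def numSamples (Δ : ℕ) (U : Finset V) : ℕ :=
  ⌈256 * ((Δ : ℝ) + 1) ^ 2 * Real.log (U.card : ℝ)⌉₊

/-- Compute shortest paths between `k` independent, uniformly random pairs of vertices of `U`. -/
noncomputable def samplePaths (U : Finset V) (hU : U.Nonempty) :
    ℕ → OracleProg V (List (List V))
  | 0 => pure []
  | k + 1 => do
      let a ← OracleProg.uniform U hU
      let b ← OracleProg.uniform U hU
      let P ← shortestPath U a b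
      let rest ← samplePaths U hU k
      pure (P :: rest)

open Classical in
/-- Go through a list of vertex sets `K`, compute `Partition(U, K)` for each, and stop at the first `K`
all of whose parts have less than `β |U|` vertices, if there is one. -/
noncomputable def firstBalanced (Δ : ℕ) (U : Finset V) :
    List (Finset V) → OracleProg V (Option (Finset V))
  | [] => pure none
  | K :: l => do
      let parts ← partition U K
      if ∀ P ∈ parts, (P.card : ℝ) < balance Δ * (U.card : ℝ) then pure (some K)
      else firstBalanced Δ U l

/-- One round of the search for a balanced clique separator: sample shortest paths, take a vertex `x` of
`U` that is on the largest number of them, and test all the cliques of `U` that contain `x`. -/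
noncomputable def separatorRound (Δ : ℕ) (U : Finset V) (hU : U.Nonempty) :
    OracleProg V (Option (Finset V)) := do
  let paths ← samplePaths U hU (numSamples Δ U)
  let occurrences := fun v : V => paths.countP fun P => v ∈ P
  let x := (U.exists_max_image occurrences hU).choose
  let d ← querySets {x} U
  let N := U.filter fun v => d x v ≤ 1
  let e ← querySets N N
  let cliques := N.powerset.filter fun K => x ∈ K ∧ ∀ u ∈ K, ∀ v ∈ K, e u v ≤ 1
  firstBalanced Δ U cliques.toList

/-- `Balanced-Separator(U)`: repeat the rounds until a balanced separator is found. -/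
noncomputable def balancedSeparator (Δ : ℕ) (U : Finset V) (hU : U.Nonempty) :
    OracleProg V (Finset V) :=
  OracleProg.repeatUntil (separatorRound Δ U hU)

/-- Run `f` on all members of a list, and return the union of the results. -/
def unionOver {ι β : Type} [DecidableEq β] (f : ι → OracleProg V (Finset β)) :
    List ι → OracleProg V (Finset β)
  | [] => pure ∅
  | i :: l => do
      let A ← f i
      let B ← unionOver f l
      pure (A ∪ B)

/-- `Reconstruct-Chordal(U)`: the set of the edges between vertices of `U`. (The recursion is only on
sets `P ∪ K` that are smaller than `U`; this test makes the recursion well-founded for all possible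
answers of the oracle.) -/
noncomputable def reconstructChordal (Δ : ℕ) (U : Finset V) : OracleProg V (Finset (Sym2 V)) :=
  if h : threshold Δ < U.card then do
    let K ← balancedSeparator Δ U (Finset.card_pos.1 (Nat.zero_lt_of_lt h))
    let parts ← partition U K
    unionOver
      (fun P => if (P ∪ K).card < U.card then reconstructChordal Δ (P ∪ K) else pure ∅)
      parts.toList
  else do
    let d ← querySets U U
    pure (((U ×ˢ U).filter fun p => d p.1 p.2 = 1).image fun p => s(p.1, p.2))
termination_by U.card

end ChordalReconstruction

/-! ### Expectation calculus for oracle programs -/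

namespace OracleProg

variable {V : Type} {δ : V → V → ℕ} {α β : Type}

/-! Invariant. Every set `U` in the recursion contains all geodesics between its members
(`GeodClosed`). Splitting along a clique `K` preserves this: a geodesic gains nothing by leaving
through one vertex of `K` and returning through another. For such `U` the clusters merge to exactly
the components of `U \ K`, so every edge inside `U` survives in some `P ∪ K`, which gives
correctness.

Separators. In a chordal graph, a clique whose vertices all have neighbours in a connected set `A`
outside it has a common neighbour in `A` (`exists_common_neighbor`). If a clique leaves a component
with more than half of the vertices, keep those of its vertices that see the component and add a
common neighbour inside: the big component shrinks strictly, so the process stops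
(`exists_clique_of_big_part`). Unconstrained, it ends in a clique leaving parts of at most half of
`U`. Required to keep a vertex `x`, it ends in a `β`-balanced clique through `x`, or in a set of at
least `β|U|` vertices with no geodesic through `x` between any two of them.

Sampling. Half of the pairs have their computed path hit by the first kind of clique, which has at
most `Δ + 1` vertices, so some `z` is on a fraction at least `1/(2(Δ+1))` of the paths. A vertex in
no balanced clique is on a fraction at most `1 - β² ≤ 1/(4(Δ+1))`. An exponential moment bound and a
union bound show that such a vertex beats `z` in the sample with probability at most `1/2`, so a
search for a separator costs at most twice the cost of a round in expectation
(`separatorRound_spec`, `Spec.repeatUntil`).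

Cost. One call on `m` vertices costs `O(qm)`, and the recursive calls are smaller by a factor `1 -
1/(12Δ2^Δ)`. The potential `queryBound`, of the shape `(m - (Δ+1)) · log m`, absorbs both the
per-call cost and the repetition of `K` in all the calls (`queryBound_step`). -/

theorem expect_bind (p : OracleProg V β) (k : β → OracleProg V α) (f : α → ℕ → ℝ≥0∞) :
    (p >>= k).expect δ f = p.expect δ fun b q => (k b).expect δ fun a r => f a (q + r) := rfl

theorem expect_pure (a : α) (f : α → ℕ → ℝ≥0∞) :
    (Pure.pure a : OracleProg V α).expect δ f = f a 0 := rfl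

theorem expect_uniform (S : Finset V) (hS : S.Nonempty) (f : V → ℕ → ℝ≥0∞) :
    (uniform S hS).expect δ f = (∑ s ∈ S, f s 0) / (S.card : ℝ≥0∞) := rfl

theorem expect_repeatUntil (body : OracleProg V (Option α)) (f : α → ℕ → ℝ≥0∞) :
    (repeatUntil body).expect δ f =
      ⨆ t : ℕ, loopExpect (fun g => body.expect δ g) t f := rfl

theorem loopExpect_succ (E : (Option α → ℕ → ℝ≥0∞) → ℝ≥0∞) (t : ℕ) (f : α → ℕ → ℝ≥0∞) :
    loopExpect E (t + 1) f = E fun o q => o.elim (loopExpect E t fun a r => f a (q + r))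
      (fun a => f a q) := by
  rw [loopExpect]
  congr 1
  funext o q
  cases o <;> rfl

/-- `R` holds for the result and the number of queries in almost every run that halts. -/
def AlmostSurely (δ : V → V → ℕ) (p : OracleProg V α) (R : α → ℕ → Prop) : Prop :=
  ∀ f g : α → ℕ → ℝ≥0∞, (∀ a q, R a q → f a q ≤ g a q) → p.expect δ f ≤ p.expect δ g

/-- A loop is the supremum of its truncations, so facts about loops are proved by induction on the
number of rounds and then passed to the supremum. The predicate `P` lets one induction serve both
plain monotonicity and almost sure properties. -/
theorem loopExpect_mono_of {E : (Option α → ℕ → ℝ≥0∞) → ℝ≥0∞} {P : α → Prop}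
    (hE : ∀ f g : Option α → ℕ → ℝ≥0∞,
      (∀ o q, (∀ a ∈ o, P a) → f o q ≤ g o q) → E f ≤ E g) (t : ℕ) :
    ∀ f g : α → ℕ → ℝ≥0∞, (∀ a q, P a → f a q ≤ g a q) →
      loopExpect E t f ≤ loopExpect E t g := by
  induction t with
  | zero => intro f g _; simp [loopExpect]
  | succ t ih =>
    intro f g h
    rw [loopExpect_succ, loopExpect_succ]
    refine hE _ _ fun o q ho => ?_
    cases o with
    | none => exact ih _ _ fun a r ha => h a _ ha
    | some a => exact h a q (ho a rfl)

theorem expect_mono (p : OracleProg V α) {f g : α → ℕ → ℝ≥0∞} (h : ∀ a q, f a q ≤ g a q) :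
    p.expect δ f ≤ p.expect δ g := by
  induction p with
  | pure a => exact h a 0
  | bind p k ihp ihk => exact ihp fun b q => ihk b fun a r => h a _
  | query u v => exact h _ _
  | uniform S hS =>
    exact ENNReal.div_le_div_right (Finset.sum_le_sum fun s _ => h s 0) _
  | repeatUntil body ih =>
    refine iSup_mono fun t => ?_
    exact loopExpect_mono_of (P := fun _ => True) (fun f g hfg => ih fun o q => hfg o q (by simp))
      t f g fun a q _ => h a q

theorem loopExpect_add_le {E : (Option α → ℕ → ℝ≥0∞) → ℝ≥0∞}
    (hm : ∀ f g : Option α → ℕ → ℝ≥0∞, (∀ o q, f o q ≤ g o q) → E f ≤ E g)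
    (hE : ∀ f g : Option α → ℕ → ℝ≥0∞, E (fun o q => f o q + g o q) ≤ E f + E g) (t : ℕ) :
    ∀ f g : α → ℕ → ℝ≥0∞,
      loopExpect E t (fun a q => f a q + g a q) ≤ loopExpect E t f + loopExpect E t g := by
  induction t with
  | zero => intro f g; simp [loopExpect]
  | succ t ih =>
    intro f g
    rw [loopExpect_succ, loopExpect_succ, loopExpect_succ]
    refine le_trans (hm _ _ fun o q => ?_) (hE _ _)
    cases o with
    | none => exact ih _ _
    | some a => exact le_rfl

/-- Upper bounds on costs need subadditivity only, and this half of linearity passes to the supremum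
over truncations term by term. -/
theorem expect_add_le (p : OracleProg V α) (f g : α → ℕ → ℝ≥0∞) :
    p.expect δ (fun a q => f a q + g a q) ≤ p.expect δ f + p.expect δ g := by
  induction p with
  | pure a => exact le_rfl
  | bind p k ihp ihk =>
    exact (expect_mono p fun b q => ihk b _ _).trans (ihp _ _)
  | query u v => exact le_rfl
  | uniform S hS =>
    rw [expect_uniform, expect_uniform, expect_uniform, Finset.sum_add_distrib, ENNReal.add_div]
  | repeatUntil body ih =>
    refine iSup_le fun t => (loopExpect_add_le (fun f g h => expect_mono body h) ih t f g).trans ?_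
    exact add_le_add (le_iSup (fun t => loopExpect _ t f) t) (le_iSup (fun t => loopExpect _ t g) t)

theorem loopExpect_mul_le {E : (Option α → ℕ → ℝ≥0∞) → ℝ≥0∞} (c : ℝ≥0∞)
    (hm : ∀ f g : Option α → ℕ → ℝ≥0∞, (∀ o q, f o q ≤ g o q) → E f ≤ E g)
    (hE : ∀ f : Option α → ℕ → ℝ≥0∞, E (fun o q => c * f o q) ≤ c * E f) (t : ℕ) :
    ∀ f : α → ℕ → ℝ≥0∞,
      loopExpect E t (fun a q => c * f a q) ≤ c * loopExpect E t f := by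
  induction t with
  | zero => intro f; simp [loopExpect]
  | succ t ih =>
    intro f
    rw [loopExpect_succ, loopExpect_succ]
    refine le_trans (hm _ _ fun o q => ?_) (hE _)
    cases o with
    | none => exact ih _
    | some a => exact le_rfl

theorem expect_mul_le (p : OracleProg V α) (c : ℝ≥0∞) (f : α → ℕ → ℝ≥0∞) :
    p.expect δ (fun a q => c * f a q) ≤ c * p.expect δ f := by
  induction p with
  | pure a => exact le_rfl
  | bind p k ihp ihk =>
    exact (expect_mono p fun b q => ihk b _).trans (ihp _)
  | query u v => exact le_rfl
  | uniform S hS =>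
    rw [expect_uniform, expect_uniform, ← Finset.mul_sum, mul_div_assoc]
  | repeatUntil body ih =>
    refine iSup_le fun t => (loopExpect_mul_le c (fun f g h => expect_mono body h) ih t f).trans ?_
    exact mul_le_mul_right (le_iSup (fun t => loopExpect _ t f) t) c

theorem loopExpect_one_le {E : (Option α → ℕ → ℝ≥0∞) → ℝ≥0∞}
    (hm : ∀ f g : Option α → ℕ → ℝ≥0∞, (∀ o q, f o q ≤ g o q) → E f ≤ E g)
    (hE : E (fun _ _ => 1) ≤ 1) (t : ℕ) :
    loopExpect E t (fun _ _ => 1) ≤ 1 := by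
  induction t with
  | zero => simp [loopExpect]
  | succ t ih =>
    rw [loopExpect_succ]
    refine le_trans (hm _ _ fun o q => ?_) hE
    cases o with
    | none => exact ih
    | some a => exact le_rfl

theorem expect_one_le (p : OracleProg V α) : p.expect δ (fun _ _ => 1) ≤ 1 := by
  induction p with
  | pure a => exact le_rfl
  | bind p k ihp ihk => exact (expect_mono p fun b q => ihk b).trans ihp
  | query u v => exact le_rfl
  | uniform S hS =>
    rw [expect_uniform]
    simp [ENNReal.div_self_le_one]
  | repeatUntil body ih =>
    exact iSup_le fun t => loopExpect_one_le (fun f g h => expect_mono body h) ih t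

theorem expect_const_le (p : OracleProg V α) (c : ℝ≥0∞) : p.expect δ (fun _ _ => c) ≤ c := by
  have h := expect_mul_le (δ := δ) p c fun _ _ => 1
  simp only [mul_one] at h
  exact h.trans ((mul_le_mul_right (expect_one_le p) c).trans (mul_one c).le)

theorem AlmostSurely.mono {p : OracleProg V α} {R R' : α → ℕ → Prop} (h : AlmostSurely δ p R)
    (hR : ∀ a q, R a q → R' a q) : AlmostSurely δ p R' :=
  fun f g hfg => h f g fun a q haq => hfg a q (hR a q haq)

theorem AlmostSurely.bind {p : OracleProg V β} {k : β → OracleProg V α} {R : β → ℕ → Prop}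
    {R' : α → ℕ → Prop} (hp : AlmostSurely δ p R)
    (hk : ∀ b q, R b q → AlmostSurely δ (k b) fun a r => R' a (q + r)) :
    AlmostSurely δ (p >>= k) R' := fun _ _ hfg =>
  hp _ _ fun b q hb => hk b q hb _ _ fun a _ har => hfg a _ har

theorem AlmostSurely.repeatUntil {body : OracleProg V (Option α)} {P : α → Prop}
    (h : AlmostSurely δ body fun o _ => ∀ a ∈ o, P a) :
    AlmostSurely δ (repeatUntil body) fun a _ => P a := fun f g hfg =>
  iSup_mono fun t => loopExpect_mono_of (P := P) h t f g hfg

/-- Every run of `p` halts with result `a` after `q` queries. -/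
def Runs (δ : V → V → ℕ) (p : OracleProg V α) (a : α) (q : ℕ) : Prop :=
  ∀ f : α → ℕ → ℝ≥0∞, p.expect δ f = f a q

theorem runs_pure (a : α) : Runs δ (Pure.pure a : OracleProg V α) a 0 := fun _ => rfl

theorem runs_query (u v : V) : Runs δ (query u v) (δ u v) 1 := fun _ => rfl

theorem Runs.bind {p : OracleProg V β} {k : β → OracleProg V α} {b : β} {a : α} {q r : ℕ}
    (hp : Runs δ p b q) (hk : Runs δ (k b) a r) : Runs δ (p >>= k) a (q + r) := fun f => by
  rw [expect_bind, hp, hk]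

theorem Runs.almostSurely {p : OracleProg V α} {a : α} {q : ℕ} (hp : Runs δ p a q)
    {R : α → ℕ → Prop} (h : R a q) : AlmostSurely δ p R := fun f g hfg => by
  rw [hp, hp]; exact hfg a q h

/-- `p` halts with probability one, its result satisfies `P` almost surely, and the expected number
of queries is at most `c`. -/
structure Spec (δ : V → V → ℕ) (p : OracleProg V α) (P : α → Prop) (c : ℝ≥0∞) : Prop where
  as : AlmostSurely δ p fun a _ => P a
  halts : p.expect δ (fun _ _ => 1) = 1
  cost : p.expect δ (fun _ q => (q : ℝ≥0∞)) ≤ c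

theorem Runs.spec {p : OracleProg V α} {a : α} {q : ℕ} (hp : Runs δ p a q)
    {P : α → Prop} (h : P a) {c : ℝ≥0∞} (hc : (q : ℝ≥0∞) ≤ c) : Spec δ p P c :=
  ⟨hp.almostSurely h, hp _, (hp _).trans_le hc⟩

theorem Spec.mono {p : OracleProg V α} {P P' : α → Prop} {c c' : ℝ≥0∞} (h : Spec δ p P c)
    (hP : ∀ a, P a → P' a) (hc : c ≤ c') : Spec δ p P' c' :=
  ⟨h.as.mono fun a _ => hP a, h.halts, h.cost.trans hc⟩

/-- The cost `c'` must be uniform over all results satisfying `P`; then the costs add. The almost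
sure form of `P` is what lets the continuation assume it. -/
theorem Spec.bind {p : OracleProg V β} {k : β → OracleProg V α} {P : β → Prop} {P' : α → Prop}
    {c c' : ℝ≥0∞} (hp : Spec δ p P c) (hk : ∀ b, P b → Spec δ (k b) P' c') :
    Spec δ (p >>= k) P' (c + c') where
  as := hp.as.bind fun b q hb => (hk b hb).as
  halts := by
    refine le_antisymm (expect_one_le _) ?_
    exact hp.halts.symm.trans_le (hp.as _ _ fun b q hb => (hk b hb).halts.ge)
  cost := by
    rw [expect_bind]
    calc _ ≤ p.expect δ fun _ q => (q : ℝ≥0∞) + c' := hp.as _ _ fun b _ hb => by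
            simp only [Nat.cast_add]
            exact (expect_add_le _ _ _).trans (add_le_add (expect_const_le _ _) (hk b hb).cost)
      _ ≤ _ := (expect_add_le _ _ _).trans (add_le_add hp.cost (expect_const_le _ _))

theorem Spec.probability_eq_one {p : OracleProg V α} {P : α → Prop} {c : ℝ≥0∞}
    (h : Spec δ p P c) : p.probability δ P = 1 := by
  refine le_antisymm ?_ ?_
  · refine le_trans (expect_mono p fun a q => ?_) (expect_one_le (δ := δ) p)
    split_ifs <;> simp
  · rw [← h.halts]
    exact h.as _ _ fun a q ha => by simp [ha]

/-- A loop whose rounds fail with probability at most one half. -/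
theorem Spec.repeatUntil {body : OracleProg V (Option α)} {P : α → Prop} {c : ℝ≥0∞}
    (h : Spec δ body (fun o => ∀ a ∈ o, P a) c)
    (hf : body.expect δ (fun o _ => if o.isNone then 1 else 0) ≤ 1 / 2) :
    Spec δ (OracleProg.repeatUntil body) P (2 * c) where
  as := h.as.repeatUntil
  halts := by
    refine le_antisymm (expect_one_le _) ?_
    -- The loop is still running after `t` rounds with probability at most `2⁻ᵗ`; the additive form
    -- avoids subtraction in `ℝ≥0∞`.
    have key : ∀ t : ℕ, 1 ≤ loopExpect (fun g => body.expect δ g) t (fun _ _ => 1) +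
        (1 / 2 : ℝ≥0∞) ^ t := by
      intro t
      induction t with
      | zero => simp
      | succ t ih =>
        rw [loopExpect_succ]
        calc (1 : ℝ≥0∞) = body.expect δ (fun _ _ => 1) := h.halts.symm
          _ ≤ body.expect δ (fun o q => o.elim
                (loopExpect (fun g => body.expect δ g) t fun _ _ => 1) (fun _ => 1) +
                (1 / 2 : ℝ≥0∞) ^ t * if o.isNone then 1 else 0) :=
              expect_mono _ fun o q => by
                cases o with
                | none => simpa using ih
                | some a => simp
          _ ≤ _ := by
              refine (expect_add_le _ _ _).trans (add_le_add le_rfl ?_)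
              refine (expect_mul_le _ _ _).trans ?_
              rw [pow_succ]
              exact mul_le_mul_right hf _
    rw [expect_repeatUntil]
    refine ENNReal.le_of_forall_pos_le_add fun ε hε _ => ?_
    obtain ⟨t, ht⟩ := ((ENNReal.tendsto_pow_atTop_nhds_zero_of_lt_one (r := 1 / 2)
      (by simp)).eventually_lt_const (u := (ε : ℝ≥0∞)) (by simpa using hε)).exists
    exact (key t).trans (add_le_add (le_iSup (fun t => loopExpect _ t _) t) ht.le)
  cost := by
    refine iSup_le fun t => ?_
    induction t with
    | zero => simp [loopExpect]
    | succ t ih =>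
      rw [loopExpect_succ]
      -- A failed round is followed by a loop with fewer rounds, of cost at most `2 * c` by
      -- induction, and this happens with probability at most one half: `c + 2c/2 = 2c`.
      calc _ ≤ body.expect δ (fun o q => (q : ℝ≥0∞) + (2 * c) * if o.isNone then 1 else 0) :=
            expect_mono _ fun o q => by
              cases o with
              | none =>
                simp only [Option.elim_none, Nat.cast_add, Option.isNone_none, if_true, mul_one]
                refine (loopExpect_add_le (fun f g h => expect_mono body h)
                  (fun f g => expect_add_le body f g) t _ _).trans (add_le_add ?_ ih)
                have h1 := loopExpect_mul_le (q : ℝ≥0∞) (fun f g h => expect_mono (δ := δ) body h)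
                  (fun f => expect_mul_le body _ f) t (fun _ _ => 1)
                simp only [mul_one] at h1
                refine h1.trans ((mul_le_mul_right (loopExpect_one_le
                  (fun f g h => expect_mono (δ := δ) body h) (expect_one_le body) t) _).trans
                  (mul_one _).le)
              | some a => simp
        _ ≤ c + (2 * c) * (1 / 2) := by
            refine (expect_add_le _ _ _).trans (add_le_add h.cost ?_)
            exact (expect_mul_le _ _ _).trans (mul_le_mul_right hf _)
        _ = 2 * c := by
            rw [mul_comm 2 c, mul_assoc, one_div, ENNReal.mul_inv_cancel (by simp) (by simp),
              mul_one, mul_two]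

end OracleProg

namespace ChordalReconstruction

/-! ### Merging overlapping clusters -/

section Merge

variable {V : Type} [DecidableEq V]

/-- Only overlapping sets are ever united, so a property stable under such unions survives;
connectedness is the case of interest. -/
theorem mergeClusters_forall {Q : Finset V → Prop}
    (hQ : ∀ A B, Q A → Q B → (A ∩ B).Nonempty → Q (A ∪ B)) (F : Finset (Finset V)) :
    (∀ A ∈ F, Q A) → ∀ A ∈ mergeClusters F, Q A := by
  induction F using mergeClusters.induct with
  | case1 F h ih =>
    intro hF
    rw [mergeClusters, dif_pos h]
    refine ih fun A hA => ?_
    obtain ⟨h1, h2, h3, h4⟩ := h.choose_spec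
    rcases Finset.mem_insert.1 hA with rfl | hA
    · exact hQ _ _ (hF _ h1) (hF _ h2) h4
    · exact hF _ (Finset.mem_of_mem_erase (Finset.mem_of_mem_erase hA))
  | case2 F h =>
    intro hF
    rwa [mergeClusters, dif_neg h]

theorem eq_of_mem_mergeClusters (F : Finset (Finset V)) :
    ∀ A ∈ mergeClusters F, ∀ B ∈ mergeClusters F, ∀ x ∈ A, x ∈ B → A = B := by
  induction F using mergeClusters.induct with
  | case1 F h ih =>
    rw [mergeClusters, dif_pos h]
    exact ih
  | case2 F h =>
    rw [mergeClusters, dif_neg h]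
    intro A hA B hB x hxA hxB
    by_contra hAB
    exact h ⟨(A, B), hA, hB, hAB, x, Finset.mem_inter.2 ⟨hxA, hxB⟩⟩

theorem exists_mem_mergeClusters (F : Finset (Finset V)) :
    ∀ A ∈ F, ∃ B ∈ mergeClusters F, A ⊆ B := by
  induction F using mergeClusters.induct with
  | case1 F h ih =>
    rw [mergeClusters, dif_pos h]
    intro A hA
    have hu := ih _ (Finset.mem_insert_self _ _)
    by_cases h1 : A = h.choose.1
    · subst h1
      obtain ⟨B, hB, hAB⟩ := hu
      exact ⟨B, hB, Finset.subset_union_left.trans hAB⟩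
    · by_cases h2 : A = h.choose.2
      · subst h2
        obtain ⟨B, hB, hAB⟩ := hu
        exact ⟨B, hB, Finset.subset_union_right.trans hAB⟩
      · exact ih _ (Finset.mem_insert_of_mem (Finset.mem_erase.2 ⟨h2, Finset.mem_erase.2 ⟨h1, hA⟩⟩))
  | case2 F h =>
    rw [mergeClusters, dif_neg h]
    exact fun A hA => ⟨A, hA, subset_rfl⟩

end Merge

/-! ### Sets closed under geodesics, and clique separators -/

section Geodesic

variable {V : Type} (G : SimpleGraph V)

/-- A set of vertices that contains every shortest path between two of its members. -/
def GeodClosed (U : Finset V) : Prop :=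
  ∀ a ∈ U, ∀ b ∈ U, ∀ v, G.dist a v + G.dist v b = G.dist a b → v ∈ U

/-- Any two vertices of `P` are joined by a walk in `P`. -/
def ConnIn (P : Finset V) : Prop :=
  ∀ x ∈ P, ∀ y ∈ P, ∃ p : G.Walk x y, ∀ z ∈ p.support, z ∈ P

variable {G}

theorem dist_add_dist_of_mem_support {a b v : V} (p : G.Walk a b)
    (hp : p.length = G.dist a b) (hv : v ∈ p.support) :
    G.dist a v + G.dist v b = G.dist a b := by
  classical
  have h := congrArg SimpleGraph.Walk.length (p.take_spec hv)
  rw [SimpleGraph.Walk.length_append] at h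
  have h1 := SimpleGraph.dist_le (p.takeUntil v hv)
  have h2 := SimpleGraph.dist_le (p.dropUntil v hv)
  have h3 : G.dist a b ≤ G.dist a v + G.dist v b := by
    obtain ⟨q, hq⟩ := (p.takeUntil v hv).reachable.exists_walk_length_eq_dist
    obtain ⟨r, hr⟩ := (p.dropUntil v hv).reachable.exists_walk_length_eq_dist
    have := SimpleGraph.dist_le (q.append r)
    rw [SimpleGraph.Walk.length_append] at this
    omega
  omega

theorem ConnIn.union [DecidableEq V] {A B : Finset V} (hA : ConnIn G A) (hB : ConnIn G B)
    (h : (A ∩ B).Nonempty) : ConnIn G (A ∪ B) := by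
  obtain ⟨z, hz⟩ := h
  rw [Finset.mem_inter] at hz
  have key : ∀ x ∈ A ∪ B, ∃ p : G.Walk x z, ∀ w ∈ p.support, w ∈ A ∪ B := by
    intro x hx
    rcases Finset.mem_union.1 hx with hx | hx
    · obtain ⟨p, hp⟩ := hA x hx z hz.1
      exact ⟨p, fun w hw => Finset.mem_union_left _ (hp w hw)⟩
    · obtain ⟨p, hp⟩ := hB x hx z hz.2
      exact ⟨p, fun w hw => Finset.mem_union_right _ (hp w hw)⟩
  intro x hx y hy
  obtain ⟨p, hp⟩ := key x hx
  obtain ⟨q, hq⟩ := key y hy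
  refine ⟨p.append q.reverse, fun w hw => ?_⟩
  rw [SimpleGraph.Walk.mem_support_append_iff, SimpleGraph.Walk.support_reverse,
    List.mem_reverse] at hw
  exact hw.elim (hp w) (hq w)

/-- A walk that leaves `A` meets a vertex outside `A` that is adjacent to `A`. -/
theorem exists_boundary {A : Finset V} {a b : V} (p : G.Walk a b) (ha : a ∈ A) (hb : b ∉ A) :
    ∃ u ∈ A, ∃ w ∈ p.support, w ∉ A ∧ G.Adj u w := by
  obtain ⟨d, hd, h1, h2⟩ := p.exists_boundary_dart (A : Set V) ha hb
  exact ⟨d.fst, h1, d.snd, p.dart_snd_mem_support_of_mem_darts hd, h2, d.adj⟩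

/-- A geodesic from `A` to a vertex outside stays in `U`, so the first vertex after it leaves `A`
lies in `S`. If `a` is already in `S`, then `a` itself serves. -/
theorem exists_cut_vertex (hc : G.Connected) {U A S : Finset V} (hU : GeodClosed G U)
    (hN : ∀ u ∈ A, ∀ w ∈ U, G.Adj u w → w ∈ A ∨ w ∈ S) {a v : V} (haU : a ∈ U) (hvU : v ∈ U)
    (ha : a ∈ A ∨ a ∈ S) (hv : v ∉ A) :
    ∃ s ∈ S, G.dist a s + G.dist s v = G.dist a v := by
  rcases ha with ha | ha
  · obtain ⟨p, hp⟩ := hc.exists_walk_length_eq_dist a v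
    obtain ⟨u, hu, w, hw, hwA, huw⟩ := exists_boundary p ha hv
    have hd := dist_add_dist_of_mem_support p hp hw
    exact ⟨w, (hN u hu w (hU a haU v hvU w hd) huw).resolve_left hwA, hd⟩
  · exact ⟨a, ha, by simp⟩

/-- No shortest path between two vertices of `A ∪ S` leaves `A ∪ S`, if `S` is a clique that separates
`A` from the rest. -/
theorem mem_of_dist_add_dist (hc : G.Connected) {U A S : Finset V} (hU : GeodClosed G U)
    (hN : ∀ u ∈ A, ∀ w ∈ U, G.Adj u w → w ∈ A ∨ w ∈ S)
    (hS : ∀ s ∈ S, ∀ t ∈ S, G.dist s t ≤ 1) {a b v : V} (haU : a ∈ U) (hbU : b ∈ U)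
    (ha : a ∈ A ∨ a ∈ S) (hb : b ∈ A ∨ b ∈ S) (h : G.dist a v + G.dist v b = G.dist a b) :
    v ∈ A ∨ v ∈ S := by
  by_contra hv
  rw [not_or] at hv
  have hvU := hU a haU b hbU v h
  -- A geodesic from `a` to `b` through `v` can be made to pass `s`, `v`, `t` in this order. Since
  -- `v` is not in `S`, the stretch from `s` to `t` has length at least 2, while the clique offers a
  -- shortcut of length at most 1.
  obtain ⟨s, hs, hs'⟩ := exists_cut_vertex hc hU hN haU hvU ha hv.1
  obtain ⟨t, ht, ht'⟩ := exists_cut_vertex hc hU hN hbU hvU hb hv.1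
  have h1 := hS s hs t ht
  have h2 : G.dist s v ≠ 0 := fun h0 => hv.2 ((hc.dist_eq_zero_iff.1 h0) ▸ hs)
  have h3 : G.dist t v ≠ 0 := fun h0 => hv.2 ((hc.dist_eq_zero_iff.1 h0) ▸ ht)
  have h4 := hc.dist_triangle (u := a) (v := s) (w := b)
  have h5 := hc.dist_triangle (u := s) (v := t) (w := b)
  have h6 := G.dist_comm (u := b) (v := t)
  have h7 := G.dist_comm (u := b) (v := v)
  omega

end Geodesic

/-! ### The parts are the components of `U \ S` -/

section Parts

variable {V : Type} [DecidableEq V] (G : SimpleGraph V)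

/-- The result of `Partition(U, S)`. -/
noncomputable def parts (U S : Finset V) : Finset (Finset V) :=
  mergeClusters (((U.filter fun v => ∃ s ∈ S, G.dist s v ≤ 1) \ S).image fun a =>
    (U \ S).filter fun x => ∀ s ∈ S, G.dist a x ≤ G.dist s x)

variable {G}

/-- Each cluster is star-shaped about its centre `a`: if `z` is on a geodesic from `a` to `x` and
some `s` were nearer to `z` than `a`, then it would also be nearer to `x`. So clusters are
connected, and merging keeps them so. -/
theorem parts_spec (hc : G.Connected) {U S P : Finset V} (hU : GeodClosed G U)
    (hP : P ∈ parts G U S) : P.Nonempty ∧ P ⊆ U \ S ∧ ConnIn G P := by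
  refine mergeClusters_forall (Q := fun P => P.Nonempty ∧ P ⊆ U \ S ∧ ConnIn G P) ?_ _ ?_ P hP
  · rintro A B ⟨hA, hA', hA''⟩ ⟨hB, hB', hB''⟩ hAB
    exact ⟨hA.mono Finset.subset_union_left, Finset.union_subset hA' hB', hA''.union hB'' hAB⟩
  · intro A hA
    obtain ⟨a, ha, rfl⟩ := Finset.mem_image.1 hA
    simp only [Finset.mem_sdiff, Finset.mem_filter] at ha
    have haA : a ∈ (U \ S).filter fun x => ∀ s ∈ S, G.dist a x ≤ G.dist s x := by
      simp [ha.1.1, ha.2]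
    refine ⟨⟨a, haA⟩, Finset.filter_subset _ _, ?_⟩
    have key : ∀ x ∈ (U \ S).filter fun x => ∀ s ∈ S, G.dist a x ≤ G.dist s x,
        ∃ p : G.Walk a x, ∀ z ∈ p.support,
          z ∈ (U \ S).filter fun x => ∀ s ∈ S, G.dist a x ≤ G.dist s x := by
      intro x hx
      obtain ⟨p, hp⟩ := hc.exists_walk_length_eq_dist a x
      refine ⟨p, fun z hz => ?_⟩
      have hd := dist_add_dist_of_mem_support p hp hz
      simp only [Finset.mem_filter, Finset.mem_sdiff] at hx ⊢
      have hs : ∀ s ∈ S, G.dist a z ≤ G.dist s z := by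
        intro s hs
        have h1 := hx.2 s hs
        have h2 := hc.dist_triangle (u := s) (v := z) (w := x)
        omega
      refine ⟨⟨hU a ha.1.1 x hx.1.1 z hd, fun hzS => ha.2 ?_⟩, hs⟩
      have h0 := hs z hzS
      rw [SimpleGraph.dist_self, Nat.le_zero, hc.dist_eq_zero_iff] at h0
      exact h0 ▸ hzS
    intro x hx y hy
    obtain ⟨p, hp⟩ := key x hx
    obtain ⟨q, hq⟩ := key y hy
    refine ⟨p.reverse.append q, fun w hw => ?_⟩
    rw [SimpleGraph.Walk.mem_support_append_iff, SimpleGraph.Walk.support_reverse,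
      List.mem_reverse] at hw
    exact hw.elim (hp w) (hq w)

theorem eq_of_mem_parts {U S P Q : Finset V} (hP : P ∈ parts G U S) (hQ : Q ∈ parts G U S) {x : V}
    (hxP : x ∈ P) (hxQ : x ∈ Q) : P = Q :=
  eq_of_mem_mergeClusters _ P hP Q hQ x hxP hxQ

/-- Take `s` in `S` nearest to `x` and let `a` be the next vertex on a geodesic from `s` to `x`.
Then `a` is nearer to `x` than `S` by one, and this slack pays for the edge to `y`, provided `y` is
not nearer to `S` than `x`. Hence one cluster contains both ends. -/
theorem exists_parts_of_adj (hc : G.Connected) {U S : Finset V} (hU : GeodClosed G U) (hSU : S ⊆ U)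
    (hS : S.Nonempty) {x : V} (hx : x ∈ U \ S) :
    ∃ P ∈ parts G U S, x ∈ P ∧ ∀ y ∈ U \ S, (∀ t ∈ S, ∃ s ∈ S, G.dist s x ≤ G.dist t y) → G.Adj x y →
      y ∈ P := by
  obtain ⟨s, hs, hmin⟩ := S.exists_min_image (fun s => G.dist s x) hS
  rw [Finset.mem_sdiff] at hx
  obtain ⟨p, hp⟩ := hc.exists_walk_length_eq_dist s x
  cases p with
  | nil => exact absurd hs hx.2
  | @cons _ a _ hsa p =>
    have hd := dist_add_dist_of_mem_support _ hp (v := a) (by simp)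
    have h1 : G.dist s a = 1 := SimpleGraph.dist_eq_one_iff_adj.2 hsa
    have haU : a ∈ U := hU s (hSU hs) x hx.1 a hd
    have haS : a ∉ S := fun ha => by have := hmin a ha; omega
    obtain ⟨P, hP, hsub⟩ := exists_mem_mergeClusters
      (((U.filter fun v => ∃ s ∈ S, G.dist s v ≤ 1) \ S).image fun a =>
        (U \ S).filter fun x => ∀ s ∈ S, G.dist a x ≤ G.dist s x) _
      (Finset.mem_image_of_mem _ (a := a) (by
        simp only [Finset.mem_sdiff, Finset.mem_filter]
        exact ⟨⟨haU, s, hs, h1.le⟩, haS⟩))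
    refine ⟨P, hP, hsub ?_, fun y hy hxy hadj => hsub ?_⟩
    · simp only [Finset.mem_sdiff, Finset.mem_filter]
      exact ⟨hx, fun t ht => by have := hmin t ht; omega⟩
    · rw [Finset.mem_filter]
      refine ⟨hy, fun t ht => ?_⟩
      have h2 := hmin t ht
      obtain ⟨s', hs', h3⟩ := hxy t ht
      have h6 := hmin s' hs'
      have h4 := hc.dist_triangle (u := a) (v := x) (w := y)
      have h5 : G.dist x y = 1 := SimpleGraph.dist_eq_one_iff_adj.2 hadj
      omega

theorem exists_mem_parts (hc : G.Connected) {U S : Finset V} (hU : GeodClosed G U) (hSU : S ⊆ U)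
    (hS : S.Nonempty) {x : V} (hx : x ∈ U \ S) : ∃ P ∈ parts G U S, x ∈ P :=
  let ⟨P, hP, hxP, _⟩ := exists_parts_of_adj hc hU hSU hS hx
  ⟨P, hP, hxP⟩

/-- Of two adjacent vertices outside `S`, apply the previous lemma to the one nearer to `S`; parts
being disjoint, the other lies in the same part. With connectedness, this makes the parts the
components. -/
theorem mem_parts_of_adj (hc : G.Connected) {U S : Finset V} (hU : GeodClosed G U) (hSU : S ⊆ U)
    (hS : S.Nonempty) {P : Finset V} (hP : P ∈ parts G U S) {x y : V} (hxP : x ∈ P) (hy : y ∈ U)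
    (hadj : G.Adj x y) : y ∈ P ∨ y ∈ S := by
  by_contra! h
  have hx : x ∈ U \ S := (parts_spec hc hU hP).2.1 hxP
  have hy : y ∈ U \ S := Finset.mem_sdiff.2 ⟨hy, h.2⟩
  obtain ⟨s, hs, hsmin⟩ := S.exists_min_image (fun s => G.dist s x) hS
  obtain ⟨t, ht, htmin⟩ := S.exists_min_image (fun s => G.dist s y) hS
  rcases le_total (G.dist s x) (G.dist t y) with hst | hst
  · obtain ⟨Q, hQ, hxQ, hyQ⟩ := exists_parts_of_adj hc hU hSU hS hx
    have := hyQ y hy (fun r hr => ⟨s, hs, hst.trans (htmin r hr)⟩) hadj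
    exact h.1 (eq_of_mem_parts hP hQ hxP hxQ ▸ this)
  · obtain ⟨Q, hQ, hyQ, hxQ⟩ := exists_parts_of_adj hc hU hSU hS hy
    have := hxQ x hx (fun r hr => ⟨t, ht, hst.trans (hsmin r hr)⟩) hadj.symm
    exact h.1 (eq_of_mem_parts hP hQ hxP this ▸ hyQ)

/-- The parts together with a clique separator are again closed under shortest paths. -/
theorem geodClosed_parts_union (hc : G.Connected) {U S : Finset V} (hU : GeodClosed G U)
    (hSU : S ⊆ U) (hS : S.Nonempty) (hcl : ∀ s ∈ S, ∀ t ∈ S, G.dist s t ≤ 1) {P : Finset V}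
    (hP : P ∈ parts G U S) : GeodClosed G (P ∪ S) := by
  have hPU : P ⊆ U := (parts_spec hc hU hP).2.1.trans Finset.sdiff_subset
  intro a ha b hb v hv
  exact Finset.mem_union.2 (mem_of_dist_add_dist hc hU
    (fun u hu w hw huw => mem_parts_of_adj hc hU hSU hS hP hu hw huw) hcl
    (Finset.union_subset hPU hSU ha) (Finset.union_subset hPU hSU hb)
    (Finset.mem_union.1 ha) (Finset.mem_union.1 hb) hv)

theorem sum_card_parts (hc : G.Connected) {U S : Finset V} (hU : GeodClosed G U) (hSU : S ⊆ U)
    (hS : S.Nonempty) : ∑ P ∈ parts G U S, P.card + S.card = U.card := by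
  have h : (parts G U S).biUnion id = U \ S := by
    ext x
    rw [Finset.mem_biUnion]
    exact ⟨fun ⟨P, hP, hx⟩ => (parts_spec hc hU hP).2.1 hx,
      fun hx => exists_mem_parts hc hU hSU hS hx⟩
  have h2 := Finset.card_biUnion (s := parts G U S) (t := id) fun P hP Q hQ hPQ =>
    Finset.disjoint_left.2 fun x hx hx' => hPQ (eq_of_mem_parts hP hQ hx hx')
  rw [h] at h2
  have h3 := Finset.card_sdiff_add_card_eq_card hSU
  simp only [id] at h2
  omega

theorem card_parts_le (hc : G.Connected) {U S : Finset V} (hU : GeodClosed G U) (hSU : S ⊆ U)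
    (hS : S.Nonempty) : (parts G U S).card ≤ U.card := by
  have h := sum_card_parts hc hU hSU hS
  have h2 := Finset.card_nsmul_le_sum (parts G U S) Finset.card 1
    fun P hP => (parts_spec hc hU hP).1.card_pos
  rw [smul_eq_mul, mul_one] at h2
  change (parts G U S).card ≤ ∑ P ∈ parts G U S, P.card at h2
  omega

end Parts

/-! ### Common neighbours of a clique in a chordal graph -/

section Chordal

variable {V : Type} {G : SimpleGraph V}

/-- In a chordal graph, let `s`, `t` be adjacent and let `p` be a walk outside of them, from a neighbour
of `t` to a neighbour of `s`, all of whose chords are edges of `p` and whose only vertex adjacent to `s`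
is the last one. Then the last vertex is adjacent to `t`. -/
theorem adj_of_induced_walk (hG : G.IsChordal) {s t b : V} (hst : G.Adj s t) (hsb : G.Adj b s) :
    ∀ {a : V} (p : G.Walk a b), p.IsPath → s ∉ p.support → t ∉ p.support →
      (∀ x ∈ p.support, ∀ y ∈ p.support, G.Adj x y → s(x, y) ∈ p.edges) →
      (∀ x ∈ p.support, G.Adj s x → x = b) → G.Adj t a → G.Adj t b := by
  classical
  intro a p
  induction hn : p.length using Nat.strong_induction_on generalizing a with
  | _ n ih =>
  intro hp hs ht hind hsx hta
  -- If `t` has a second neighbour on `p`, pass to the suffix of `p` starting there. Otherwise `s,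
  -- t, a, …, b, s` is a cycle in which neither `s` nor `t` has a further neighbour, hence without a
  -- chord, unless `t` is adjacent to `b`.
  by_cases hex : ∃ x ∈ p.support, x ≠ a ∧ G.Adj t x
  · obtain ⟨x, hx, hxa, htx⟩ := hex
    have hsub : (p.dropUntil x hx).support ⊆ p.support := p.support_dropUntil_subset_support hx
    have hlen : (p.dropUntil x hx).length < n := by
      have := congrArg SimpleGraph.Walk.length (p.take_spec hx)
      rw [SimpleGraph.Walk.length_append] at this
      have h0 : (p.takeUntil x hx).length ≠ 0 := fun h0 =>
        hxa (SimpleGraph.Walk.eq_of_length_eq_zero h0).symm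
      omega
    refine ih _ hlen (p.dropUntil x hx) rfl (hp.dropUntil hx) (fun h => hs (hsub h))
      (fun h => ht (hsub h)) ?_ (fun y hy => hsx y (hsub hy)) htx
    intro y hy z hz hyz
    have he := hind y (hsub hy) z (hsub hz) hyz
    rw [← p.take_spec hx, SimpleGraph.Walk.edges_append, List.mem_append] at he
    refine he.resolve_left fun he => ?_
    have hd : ((p.takeUntil x hx).append (p.dropUntil x hx)).IsPath := by rwa [p.take_spec hx]
    have hy1 := SimpleGraph.Walk.fst_mem_support_of_mem_edges _ he
    have hz1 := SimpleGraph.Walk.snd_mem_support_of_mem_edges _ he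
    -- Prefix and suffix of a path share only `x`, so an edge between suffix vertices cannot be an
    -- edge of the prefix.
    have key : ∀ w, w ∈ (p.takeUntil x hx).support → w ∈ (p.dropUntil x hx).support → w = x := by
      intro w hw1 hw2
      by_contra hwx
      have hnd := hd.support_nodup
      rw [SimpleGraph.Walk.support_append, List.nodup_append] at hnd
      rw [SimpleGraph.Walk.mem_support_iff] at hw2
      exact hnd.2.2 w hw1 w (hw2.resolve_left hwx) rfl
    exact hyz.ne ((key y hy1 hy).trans (key z hz1 hz).symm)
  · push Not at hex
    by_contra htb
    have hab : a ≠ b := fun h => htb (h ▸ hta)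
    have hl : p.length ≠ 0 := fun h => hab (SimpleGraph.Walk.eq_of_length_eq_zero h)
    have htb' : t ≠ b := fun h => ht (h ▸ p.end_mem_support)
    set c : G.Walk s s := SimpleGraph.Walk.cons hst (SimpleGraph.Walk.cons hta (p.concat hsb))
      with hcdef
    have hcyc : c.IsCycle := by
      rw [hcdef, SimpleGraph.Walk.cons_isCycle_iff]
      refine ⟨?_, ?_⟩
      · rw [SimpleGraph.Walk.cons_isPath_iff]
        refine ⟨hp.concat hs hsb, ?_⟩
        rw [SimpleGraph.Walk.support_concat]
        simp [ht, hst.ne']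
      · rw [SimpleGraph.Walk.edges_cons, SimpleGraph.Walk.edges_concat]
        simp only [List.mem_cons, List.concat_eq_append, List.mem_append, List.not_mem_nil, or_false,
          not_or, Sym2.eq_iff]
        refine ⟨?_, ?_, ?_⟩
        · exact not_or.1 <| by
            rintro (⟨h, -⟩ | ⟨h, -⟩)
            · exact hst.ne h
            · exact hs (h ▸ p.start_mem_support)
        · exact fun h => hs (SimpleGraph.Walk.fst_mem_support_of_mem_edges _ h)
        · exact not_or.1 <| by
            rintro (⟨h, -⟩ | ⟨-, h⟩)
            · exact hs (h ▸ p.end_mem_support)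
            · exact htb' h
    -- The length is `p.length + 3`, which exceeds three because `a ≠ b`.
    obtain ⟨x, hx, y, hy, hxy, hne⟩ := hG s c hcyc (by
      simp only [hcdef, SimpleGraph.Walk.length_cons, SimpleGraph.Walk.length_concat]; omega)
    simp only [hcdef, SimpleGraph.Walk.support_cons, SimpleGraph.Walk.support_concat,
      SimpleGraph.Walk.edges_cons, SimpleGraph.Walk.edges_concat, List.mem_cons,
      List.concat_eq_append, List.mem_append, List.not_mem_nil, or_false, not_or] at hx hy hne
    obtain ⟨n1, n2, n3, n4⟩ := hne
    have hS : ∀ w ∈ p.support, G.Adj s w → s(s, w) = s(b, s) := fun w hw h => by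
      rw [hsx w hw h, Sym2.eq_swap]
    have hT : ∀ w ∈ p.support, G.Adj t w → s(t, w) = s(t, a) := fun w hw h => by
      by_cases hwa : w = a
      · rw [hwa]
      · exact absurd h (hex w hw hwa)
    rcases hx with rfl | rfl | hx | rfl <;> rcases hy with rfl | rfl | hy | rfl <;>
      first
      | exact hxy.ne rfl
      | exact n1 rfl
      | exact n1 Sym2.eq_swap
      | exact n4 (hS _ hy hxy)
      | exact n2 (hT _ hy hxy)
      | exact n4 (Sym2.eq_swap.trans (hS _ hx hxy.symm))
      | exact n2 (Sym2.eq_swap.trans (hT _ hx hxy.symm))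
      | exact n3 (hind _ hx _ hy hxy)

/-- Take a shortest walk in `A` from `a` to any neighbour of `s`, minimal over all end vertices at
once. A chord would shorten it, and an earlier neighbour of `s` would allow stopping sooner. -/
theorem exists_induced_walk {A : Finset V} {a s : V}
    (h : ∃ (b : V) (p : G.Walk a b), (∀ z ∈ p.support, z ∈ A) ∧ G.Adj b s) :
    ∃ (b : V) (p : G.Walk a b), (∀ z ∈ p.support, z ∈ A) ∧ G.Adj b s ∧ p.IsPath ∧
      (∀ x ∈ p.support, ∀ y ∈ p.support, G.Adj x y → s(x, y) ∈ p.edges) ∧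
      ∀ x ∈ p.support, G.Adj s x → x = b := by
  classical
  have hex : ∃ n : ℕ, ∃ (b : V) (p : G.Walk a b),
      (∀ z ∈ p.support, z ∈ A) ∧ G.Adj b s ∧ p.length = n := by
    obtain ⟨b, p, hp, hb⟩ := h
    exact ⟨_, b, p, hp, hb, rfl⟩
  obtain ⟨b, p₀, hA₀, hb, hlen₀⟩ := Nat.find_spec hex
  have hmin : ∀ (c : V) (q : G.Walk a c), (∀ z ∈ q.support, z ∈ A) → G.Adj c s →
      p₀.length ≤ q.length := fun c q hq hc => hlen₀.trans_le (Nat.find_min' hex ⟨c, q, hq, hc, rfl⟩)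
  obtain ⟨p, hp, hA, hmin⟩ : ∃ p : G.Walk a b, p.IsPath ∧ (∀ z ∈ p.support, z ∈ A) ∧
      ∀ (c : V) (q : G.Walk a c), (∀ z ∈ q.support, z ∈ A) → G.Adj c s → p.length ≤ q.length :=
    ⟨p₀.bypass, p₀.bypass_isPath, fun z hz => hA₀ z (p₀.support_bypass_subset_support hz),
      fun c q hq hc => p₀.length_bypass_le_length.trans (hmin c q hq hc)⟩
  refine ⟨b, p, hA, hb, hp, ?_, ?_⟩
  · have key : ∀ i j : ℕ, i < j → j ≤ p.length → G.Adj (p.getVert i) (p.getVert j) →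
        s(p.getVert i, p.getVert j) ∈ p.edges := by
      intro i j hij hj hadj
      by_cases hj' : j = i + 1
      · subst hj'
        exact p.mem_edges_toSubgraph.1 (p.toSubgraph_adj_getVert hj)
      · have := hmin b ((p.take i).append (SimpleGraph.Walk.cons hadj (p.drop j))) (fun z hz => by
          rw [SimpleGraph.Walk.mem_support_append_iff, SimpleGraph.Walk.support_cons,
            List.mem_cons] at hz
          rcases hz with hz | rfl | hz
          · exact hA z ((p.isSubwalk_take i).support_subset hz)
          · exact hA _ (p.getVert_mem_support i)
          · exact hA z ((p.isSubwalk_drop j).support_subset hz)) hb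
        rw [SimpleGraph.Walk.length_append, SimpleGraph.Walk.length_cons,
          SimpleGraph.Walk.take_length, SimpleGraph.Walk.drop_length] at this
        omega
    intro x hx y hy hxy
    obtain ⟨i, rfl, hi⟩ := SimpleGraph.Walk.mem_support_iff_exists_getVert.1 hx
    obtain ⟨j, rfl, hj⟩ := SimpleGraph.Walk.mem_support_iff_exists_getVert.1 hy
    rcases lt_trichotomy i j with h | h | h
    · exact key i j h hj hxy
    · exact absurd (congrArg p.getVert h) hxy.ne
    · rw [Sym2.eq_swap]
      exact key j i h hi hxy.symm
  · intro x hx hsx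
    by_contra hxb
    have h1 := hmin x (p.takeUntil x hx)
      (fun z hz => hA z (p.support_takeUntil_subset_support hx hz)) hsx.symm
    exact absurd (p.length_takeUntil_lt_length hx hxb) (not_lt.2 h1)

/-- In a chordal graph, a clique all of whose vertices have neighbours in a connected set `A` has a
common neighbour in `A`. -/
theorem exists_common_neighbor (hG : G.IsChordal) {A S : Finset V} (hA : ConnIn G A)
    (hne : A.Nonempty) (hdisj : ∀ s ∈ S, s ∉ A)
    (hS : ∀ s ∈ S, ∀ t ∈ S, s ≠ t → G.Adj s t) (hN : ∀ s ∈ S, ∃ a ∈ A, G.Adj s a) :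
    ∃ a ∈ A, ∀ s ∈ S, G.Adj s a := by
  classical
  -- Extremal choice: `a` sees as many vertices of `S` as possible. If it missed `s`, an induced
  -- path to a neighbour `b` of `s` would make `b` see all that `a` sees, and `s` as well.
  obtain ⟨a, ha, hmax⟩ := A.exists_max_image (fun a => (S.filter fun s => G.Adj s a).card) hne
  refine ⟨a, ha, fun s hs => ?_⟩
  by_contra hsa
  obtain ⟨b, p, hpA, hbs, hp, hind, hsx⟩ := exists_induced_walk (G := G) (A := A) (a := a) (s := s) (by
    obtain ⟨b, hb, hsb⟩ := hN s hs
    obtain ⟨p, hp⟩ := hA a ha b hb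
    exact ⟨b, p, hp, hsb.symm⟩)
  refine absurd (hmax b (hpA b p.end_mem_support)) (not_le.2 (Finset.card_lt_card ?_))
  rw [Finset.ssubset_iff_of_subset]
  · exact ⟨s, Finset.mem_filter.2 ⟨hs, hbs.symm⟩, fun h => hsa (Finset.mem_filter.1 h).2⟩
  · intro t ht
    rw [Finset.mem_filter] at ht ⊢
    refine ⟨ht.1, adj_of_induced_walk hG (hS s hs t ht.1 fun h => hsa (h ▸ ht.2)) hbs p hp
      (fun h => hdisj s hs (hpA s h)) (fun h => hdisj t ht.1 (hpA t h)) hind hsx ht.2⟩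

end Chordal

/-! ### Balanced clique separators and vertices on many geodesics -/

section Separators

variable {V : Type} [DecidableEq V] {G : SimpleGraph V}

/-- Let `A` be a part of more than half of the vertices, left by a clique. Moving the clique towards `A`
as long as possible ends with a clique that leaves no big part, or with a vertex of `X` that would have
to be given up. -/
theorem exists_clique_of_big_part (hc : G.Connected) (hG : G.IsChordal) {U : Finset V}
    (hU : GeodClosed G U) {big : ℕ → Prop} (hbig : ∀ k, big k → U.card < 2 * k) (X : Finset V)
    {K A : Finset V} (hKU : K ⊆ U) (hK : K.Nonempty) (hXK : X ⊆ K)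
    (hcl : ∀ s ∈ K, ∀ t ∈ K, G.dist s t ≤ 1) (hA : A ∈ parts G U K) (hAbig : big A.card) :
    (∃ K' ⊆ U, K'.Nonempty ∧ X ⊆ K' ∧ (∀ s ∈ K', ∀ t ∈ K', G.dist s t ≤ 1) ∧
      ∀ P ∈ parts G U K', ¬ big P.card) ∨
    ∃ K' ⊆ U, K'.Nonempty ∧ (∀ s ∈ K', ∀ t ∈ K', G.dist s t ≤ 1) ∧
      ∃ A ∈ parts G U K', big A.card ∧ ∃ x ∈ X, x ∈ K' ∧ ∀ a ∈ A, ¬ G.Adj x a := by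
  classical
  induction hn : A.card using Nat.strong_induction_on generalizing K A with
  | _ n ih =>
  by_cases hX : ∃ x ∈ X, ∀ a ∈ A, ¬ G.Adj x a
  · obtain ⟨x, hx, hxA⟩ := hX
    exact Or.inr ⟨K, hKU, hK, hcl, A, hA, hAbig, x, hx, hXK hx, hxA⟩
  push Not at hX
  obtain ⟨hAne, hAsub, hAconn⟩ := parts_spec hc hU hA
  have hAK : ∀ s ∈ K, s ∉ A := fun s hs hsA => (Finset.mem_sdiff.1 (hAsub hsA)).2 hs
  have hAU : A ⊆ U := hAsub.trans Finset.sdiff_subset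
  -- The next clique consists of the vertices of `K` that see `A` and a common neighbour `a` of them
  -- in `A`. It still contains `X`, since every vertex of `X` sees `A` here.
  set S := K.filter fun s => ∃ a ∈ A, G.Adj s a with hS
  have hSK : S ⊆ K := Finset.filter_subset _ _
  obtain ⟨a, ha, haS⟩ := exists_common_neighbor hG hAconn hAne
    (fun s hs => hAK s (hSK hs))
    (fun s hs t ht hst => by
      have h1 := hcl s (hSK hs) t (hSK ht)
      have h2 : G.dist s t ≠ 0 := fun h => hst (hc.dist_eq_zero_iff.1 h)
      exact SimpleGraph.dist_eq_one_iff_adj.1 (by omega))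
    (fun s hs => (Finset.mem_filter.1 hs).2)
  have hK'U : insert a S ⊆ U := Finset.insert_subset (hAU ha) (hSK.trans hKU)
  have hK'cl : ∀ s ∈ insert a S, ∀ t ∈ insert a S, G.dist s t ≤ 1 := by
    intro s hs t ht
    rcases Finset.mem_insert.1 hs with hs' | hs' <;> rcases Finset.mem_insert.1 ht with ht' | ht'
    · simp [hs', ht']
    · exact hs' ▸ (SimpleGraph.dist_eq_one_iff_adj.2 (haS t ht').symm).le
    · exact ht' ▸ (SimpleGraph.dist_eq_one_iff_adj.2 (haS s hs')).le
    · exact hcl s (hSK hs') t (hSK ht')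
  have hXK' : X ⊆ insert a S := fun x hx =>
    Finset.mem_insert_of_mem (Finset.mem_filter.2 ⟨hXK hx, hX x hx⟩)
  by_cases hbal : ∀ P ∈ parts G U (insert a S), ¬ big P.card
  · exact Or.inl ⟨_, hK'U, Finset.insert_nonempty _ _, hXK', hK'cl, hbal⟩
  push Not at hbal
  obtain ⟨P, hP, hPbig⟩ := hbal
  obtain ⟨-, hPsub, hPconn⟩ := parts_spec hc hU hP
  -- Both `P` and `A` hold more than half of `U`, so they meet. As `P` is connected and the only
  -- exits from `A` are in `S`, which `P` avoids, `P` stays in `A`; it also misses `a`, so it is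
  -- smaller.
  have hPA : P ⊆ A := by
    obtain ⟨x, hxP, hxA⟩ : ∃ x ∈ P, x ∈ A := by
      by_contra! hdis
      have h1 := Finset.card_le_card
        (Finset.union_subset (hPsub.trans Finset.sdiff_subset) hAU)
      rw [Finset.card_union_of_disjoint (Finset.disjoint_left.2 hdis)] at h1
      have h2 := hbig _ hPbig
      have h3 := hbig _ hAbig
      omega
    intro y hy
    by_contra hyA
    obtain ⟨p, hp⟩ := hPconn x hxP y hy
    obtain ⟨u, hu, w, hw, hwA, huw⟩ := exists_boundary p hxA hyA
    have hwP := Finset.mem_sdiff.1 (hPsub (hp w hw))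
    have hwK := (mem_parts_of_adj hc hU hKU hK hA hu hwP.1 huw).resolve_left hwA
    exact hwP.2 (Finset.mem_insert_of_mem (Finset.mem_filter.2 ⟨hwK, u, hu, huw.symm⟩))
  refine ih P.card ?_ hK'U (Finset.insert_nonempty _ _) hXK' hK'cl hP hPbig rfl
  rw [← hn]
  exact Finset.card_lt_card ((Finset.ssubset_iff_of_subset hPA).2
    ⟨a, ha, fun haP => (Finset.mem_sdiff.1 (hPsub haP)).2 (Finset.mem_insert_self _ _)⟩)

/-- With `X = ∅` nothing can be given up, so the descent ends in a balanced clique. -/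
theorem exists_half_clique (hc : G.Connected) (hG : G.IsChordal) {U : Finset V}
    (hU : GeodClosed G U) (hne : U.Nonempty) :
    ∃ K ⊆ U, K.Nonempty ∧ (∀ s ∈ K, ∀ t ∈ K, G.dist s t ≤ 1) ∧
      ∀ P ∈ parts G U K, 2 * P.card ≤ U.card := by
  obtain ⟨x, hx⟩ := hne
  by_cases h : ∀ P ∈ parts G U {x}, 2 * P.card ≤ U.card
  · exact ⟨{x}, by simpa using hx, by simp, by simp, h⟩
  push Not at h
  obtain ⟨A, hA, hAbig⟩ := h
  rcases exists_clique_of_big_part hc hG hU (big := fun k => U.card < 2 * k) (fun k h => h) ∅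
    (K := {x}) (by simpa using hx) (by simp) (by simp) (by simp) hA hAbig with
    ⟨K, hKU, hK, -, hcl, hP⟩ | ⟨K, -, -, -, A, -, -, y, hy, -⟩
  · exact ⟨K, hKU, hK, hcl, fun P hP' => not_lt.1 (hP P hP')⟩
  · simp at hy

/-- The descent is run with `X = {x}`. If it gets stuck at a big part `A` that `x` does not see, the
geodesics of `A` stay in `A` together with the clique vertices that see `A`, hence avoid `x`. -/
theorem exists_clique_or_avoiding (hc : G.Connected) (hG : G.IsChordal) {U : Finset V}
    (hU : GeodClosed G U) {big : ℕ → Prop} (hbig : ∀ k, big k → U.card < 2 * k) {x : V}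
    (hx : x ∈ U) :
    (∃ K ⊆ U, x ∈ K ∧ (∀ s ∈ K, ∀ t ∈ K, G.dist s t ≤ 1) ∧ ∀ P ∈ parts G U K, ¬ big P.card) ∨
    ∃ A ⊆ U, big A.card ∧ ∀ a ∈ A, ∀ b ∈ A, G.dist a x + G.dist x b ≠ G.dist a b := by
  classical
  by_cases h : ∀ P ∈ parts G U {x}, ¬ big P.card
  · exact Or.inl ⟨{x}, by simpa using hx, by simp, by simp, h⟩
  push Not at h
  obtain ⟨B, hB, hBbig⟩ := h
  rcases exists_clique_of_big_part hc hG hU hbig {x}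
    (K := {x}) (by simpa using hx) (by simp) (by simp) (by simp) hB hBbig with
    ⟨K, hKU, hK, hxK, hcl, hP⟩ | ⟨K, hKU, hK, hcl, A, hA, hAbig, y, hy, hyK, hyA⟩
  · exact Or.inl ⟨K, hKU, by simpa using hxK, hcl, hP⟩
  · rw [Finset.mem_singleton] at hy
    subst hy
    obtain ⟨-, hAsub, -⟩ := parts_spec hc hU hA
    have hAU : A ⊆ U := hAsub.trans Finset.sdiff_subset
    refine Or.inr ⟨A, hAU, hAbig, fun a ha b hb hab => ?_⟩
    have hm := mem_of_dist_add_dist hc hU (A := A) (S := K.filter fun s => ∃ a ∈ A, G.Adj s a)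
      (fun u hu w hw huw => (mem_parts_of_adj hc hU hKU hK hA hu hw huw).imp id fun hwK =>
        Finset.mem_filter.2 ⟨hwK, u, hu, huw.symm⟩)
      (fun s hs t ht => hcl s (Finset.mem_filter.1 hs).1 t (Finset.mem_filter.1 ht).1)
      (hAU ha) (hAU hb) (Or.inl ha) (Or.inl hb) hab
    rcases hm with hm | hm
    · exact (Finset.mem_sdiff.1 (hAsub hm)).2 hyK
    · obtain ⟨a, ha, hya⟩ := (Finset.mem_filter.1 hm).2
      exact hyA a ha hya

/-- If a clique leaves only parts of at most half of the vertices, then one of its vertices is on many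
shortest paths. -/
theorem exists_heavy_vertex (hc : G.Connected) (hG : G.IsChordal) {U : Finset V}
    (hU : GeodClosed G U) (hne : U.Nonempty) {D : ℕ}
    (hD : ∀ K : Finset V, (∀ s ∈ K, ∀ t ∈ K, G.dist s t ≤ 1) → K.card ≤ D)
    (path : V → V → List V)
    (hpath : ∀ a ∈ U, ∀ b ∈ U, ∃ p : G.Walk a b, p.length = G.dist a b ∧ path a b = p.support) :
    ∃ z ∈ U, U.card ^ 2 ≤ 2 * D * ((U ×ˢ U).filter fun q => z ∈ path q.1 q.2).card := by
  classical
  obtain ⟨K, hKU, hK, hcl, hP⟩ := exists_half_clique hc hG hU hne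
  -- A path that misses `K` stays in one part, and the parts have at most half of the vertices, so
  -- at most half of all pairs are of this kind.
  have hcompl : ((U ×ˢ U).filter fun q => ∀ z ∈ K, z ∉ path q.1 q.2) ⊆
      (parts G U K).biUnion fun P => P ×ˢ P := by
    rintro ⟨a, b⟩ hab
    rw [Finset.mem_filter, Finset.mem_product] at hab
    obtain ⟨⟨ha, hb⟩, hz⟩ := hab
    obtain ⟨p, hp, hpe⟩ := hpath a ha b hb
    rw [hpe] at hz
    obtain ⟨P, hPm, haP⟩ := exists_mem_parts hc hU hKU hK
      (Finset.mem_sdiff.2 ⟨ha, fun h => hz a h p.start_mem_support⟩)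
    rw [Finset.mem_biUnion]
    refine ⟨P, hPm, Finset.mem_product.2 ⟨haP, ?_⟩⟩
    by_contra hbP
    obtain ⟨u, hu, w, hw, hwP, huw⟩ := exists_boundary p haP hbP
    have hwU : w ∈ U := hU a ha b hb w (dist_add_dist_of_mem_support p hp hw)
    exact hz w ((mem_parts_of_adj hc hU hKU hK hPm hu hwU huw).resolve_left hwP) hw
  have h1 : 2 * ((U ×ˢ U).filter fun q => ∀ z ∈ K, z ∉ path q.1 q.2).card ≤ U.card ^ 2 := by
    calc _ ≤ 2 * ∑ P ∈ parts G U K, P.card * P.card :=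
          Nat.mul_le_mul_left _ ((Finset.card_le_card hcompl).trans
            (Finset.card_biUnion_le.trans_eq (by simp only [Finset.card_product])))
      _ = ∑ P ∈ parts G U K, (2 * P.card) * P.card := by
          rw [Finset.mul_sum]; exact Finset.sum_congr rfl fun P _ => by ring
      _ ≤ ∑ P ∈ parts G U K, U.card * P.card :=
          Finset.sum_le_sum fun P hPm => Nat.mul_le_mul_right _ (hP P hPm)
      _ = U.card * ∑ P ∈ parts G U K, P.card := by rw [Finset.mul_sum]
      _ ≤ U.card ^ 2 := by
          have := sum_card_parts hc hU hKU hK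
          rw [sq]
          exact Nat.mul_le_mul_left _ (by omega)
  have h2 := Finset.card_filter_add_card_filter_not (s := U ×ˢ U)
    (fun q => ∀ z ∈ K, z ∉ path q.1 q.2)
  rw [Finset.card_product, ← sq] at h2
  have h3 : ((U ×ˢ U).filter fun q => ¬ ∀ z ∈ K, z ∉ path q.1 q.2).card ≤
      ∑ z ∈ K, ((U ×ˢ U).filter fun q => z ∈ path q.1 q.2).card := by
    refine (Finset.card_le_card fun q hq => ?_).trans Finset.card_biUnion_le
    rw [Finset.mem_filter] at hq
    obtain ⟨hq, hz⟩ := hq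
    push Not at hz
    obtain ⟨z, hz, hz'⟩ := hz
    exact Finset.mem_biUnion.2 ⟨z, hz, Finset.mem_filter.2 ⟨hq, hz'⟩⟩
  -- Pigeonhole: at least half of the pairs are hit by `K`, which has at most `D` vertices.
  obtain ⟨z, hz, hmax⟩ := K.exists_max_image
    (fun z => ((U ×ˢ U).filter fun q => z ∈ path q.1 q.2).card) hK
  refine ⟨z, hKU hz, ?_⟩
  have h4 := Finset.sum_le_card_nsmul K _ _ hmax
  rw [smul_eq_mul] at h4
  have h5 := Nat.mul_le_mul_right ((U ×ˢ U).filter fun q => z ∈ path q.1 q.2).card (hD K hcl)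
  rw [mul_assoc]
  omega

theorem card_clique_le [Fintype V] [DecidableRel G.Adj] (hc : G.Connected) {K : Finset V}
    (hcl : ∀ s ∈ K, ∀ t ∈ K, G.dist s t ≤ 1) : K.card ≤ G.maxDegree + 1 := by
  rcases K.eq_empty_or_nonempty with rfl | ⟨x, hx⟩
  · simp
  · have hsub : K ⊆ insert x (G.neighborFinset x) := fun y hy => by
      rw [Finset.mem_insert, SimpleGraph.mem_neighborFinset]
      by_cases h : x = y
      · exact Or.inl h.symm
      · refine Or.inr (SimpleGraph.dist_eq_one_iff_adj.1 ?_)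
        have h2 : G.dist x y ≠ 0 := fun h0 => h (hc.dist_eq_zero_iff.1 h0)
        have := hcl x hx y hy
        omega
    refine (Finset.card_le_card hsub).trans ((Finset.card_insert_le _ _).trans ?_)
    exact Nat.add_le_add_right (G.degree_le_maxDegree x) 1

theorem card_filter_dist_le_one [Fintype V] [DecidableRel G.Adj] (hc : G.Connected) (U : Finset V)
    (x : V) : (U.filter fun v => G.dist x v ≤ 1).card ≤ G.maxDegree + 1 := by
  have hsub : (U.filter fun v => G.dist x v ≤ 1) ⊆ insert x (G.neighborFinset x) := fun y hy => by
    rw [Finset.mem_insert, SimpleGraph.mem_neighborFinset]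
    by_cases h : x = y
    · exact Or.inl h.symm
    · refine Or.inr (SimpleGraph.dist_eq_one_iff_adj.1 ?_)
      have h2 : G.dist x y ≠ 0 := fun h0 => h (hc.dist_eq_zero_iff.1 h0)
      have := (Finset.mem_filter.1 hy).2
      omega
  refine (Finset.card_le_card hsub).trans ((Finset.card_insert_le _ _).trans ?_)
  exact Nat.add_le_add_right (G.degree_le_maxDegree x) 1

theorem card_filter_near_le [Fintype V] [DecidableRel G.Adj] (hc : G.Connected) (U S : Finset V) :
    (U.filter fun v => ∃ s ∈ S, G.dist s v ≤ 1).card ≤ S.card * (G.maxDegree + 1) := by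
  have hsub : (U.filter fun v => ∃ s ∈ S, G.dist s v ≤ 1) ⊆
      S.biUnion fun s => U.filter fun v => G.dist s v ≤ 1 := fun v hv => by
    obtain ⟨hv, s, hs, h⟩ := Finset.mem_filter.1 hv
    exact Finset.mem_biUnion.2 ⟨s, hs, Finset.mem_filter.2 ⟨hv, h⟩⟩
  exact (Finset.card_le_card hsub).trans
    (Finset.card_biUnion_le_card_mul _ _ _ fun s _ => card_filter_dist_le_one hc U s)

end Separators

open OracleProg hiding pure bind

/-! ### Subroutines without randomness, with exact query counts -/

section Deterministic

variable {V : Type} [DecidableEq V]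

theorem runs_queryList (δ : V → V → ℕ) (l : List (V × V)) :
    ∃ d, Runs δ (queryList l) d l.length ∧ ∀ u v, (u, v) ∈ l → d u v = δ u v := by
  induction l with
  | nil => exact ⟨_, runs_pure _, by simp⟩
  | cons p l ih =>
    obtain ⟨u, v⟩ := p
    obtain ⟨d, hd, hd'⟩ := ih
    refine ⟨fun u' v' => if u' = u ∧ v' = v then δ u v else d u' v', ?_, ?_⟩
    · have h := (runs_query (δ := δ) u v).bind (k := fun d : ℕ => queryList l >>= fun table =>
        pure fun u' v' => if u' = u ∧ v' = v then d else table u' v') (hd.bind (runs_pure _))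
      rw [List.length_cons, add_comm]
      exact h
    · intro u' v' h
      by_cases h' : u' = u ∧ v' = v
      · simp [h'.1, h'.2]
      · beta_reduce
        rw [if_neg h']
        refine hd' u' v' ((List.mem_cons.1 h).resolve_left fun h => h' ?_)
        exact ⟨congrArg Prod.fst h, congrArg Prod.snd h⟩

theorem runs_querySets (δ : V → V → ℕ) (S T : Finset V) :
    ∃ d, Runs δ (querySets S T) d (S.card * T.card) ∧ ∀ u ∈ S, ∀ v ∈ T, d u v = δ u v := by
  obtain ⟨d, hd, hd'⟩ := runs_queryList δ (S ×ˢ T).toList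
  rw [Finset.length_toList, Finset.card_product] at hd
  exact ⟨d, hd, fun u hu v hv => hd' u v (by simp [hu, hv])⟩

variable {G : SimpleGraph V}

theorem runs_partition (U S : Finset V) :
    Runs G.dist (partition U S) (parts G U S)
      (S.card * U.card + (U.filter fun v => ∃ s ∈ S, G.dist s v ≤ 1).card * U.card) := by
  obtain ⟨d, hd, hd'⟩ := runs_querySets G.dist S U
  have hN : (U.filter fun v => ∃ s ∈ S, d s v ≤ 1) = U.filter fun v => ∃ s ∈ S, G.dist s v ≤ 1 :=
    Finset.filter_congr fun v hv => exists_congr fun s =>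
      and_congr_right fun hs => by rw [hd' s hs v hv]
  obtain ⟨e, he, he'⟩ := runs_querySets G.dist (U.filter fun v => ∃ s ∈ S, d s v ≤ 1) U
  have hparts : mergeClusters (((U.filter fun v => ∃ s ∈ S, d s v ≤ 1) \ S).image fun a =>
      (U \ S).filter fun x => ∀ s ∈ S, e a x ≤ d s x) = parts G U S := by
    rw [parts, ← hN]
    congr 1
    refine Finset.image_congr fun a ha => Finset.filter_congr fun x hx => ?_
    refine forall_congr' fun s => imp_congr_right fun hs => ?_
    have hx' := (Finset.mem_sdiff.1 hx).1
    rw [hd' s hs x hx', he' a (Finset.mem_sdiff.1 ha).1 x hx']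
  have h := hd.bind (k := fun d : V → V → ℕ => (querySets (U.filter fun v => ∃ s ∈ S, d s v ≤ 1) U >>= fun e =>
    pure (mergeClusters (((U.filter fun v => ∃ s ∈ S, d s v ≤ 1) \ S).image fun a =>
      (U \ S).filter fun x => ∀ s ∈ S, e a x ≤ d s x)))) (he.bind (runs_pure _))
  rw [hparts, hN] at h
  exact h

/-- `W` need only contain the interior vertices of geodesics, since the recursive calls drop the
endpoints. The distance halves at each level, and one level queries each candidate twice, whence the
logarithm. Bounding `q + 1` instead of `q` makes the induction close: the two recursive `+ 1`s pay
for the query of the pair and for the `+ 1` of the caller. -/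
theorem runs_shortestPath (hc : G.Connected) (W : Finset V) (a b : V)
    (hW : ∀ v, G.dist a v + G.dist v b = G.dist a b → v ≠ a → v ≠ b → v ∈ W) :
    ∃ (p : G.Walk a b) (q : ℕ), p.length = G.dist a b ∧
      Runs G.dist (shortestPath W a b) p.support q ∧
      q + 1 ≤ 2 * W.card * Nat.clog 2 (G.dist a b) + 2 * max (G.dist a b) 1 := by
  induction hn : W.card using Nat.strong_induction_on generalizing W a b with
  | _ n ih =>
  by_cases hD : 1 < G.dist a b
  · obtain ⟨da, hda, hda'⟩ := runs_querySets G.dist {a} W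
    obtain ⟨db, hdb, hdb'⟩ := runs_querySets G.dist {b} W
    replace hda' : ∀ v ∈ W, da a v = G.dist a v := fun v hv => hda' a (by simp) v hv
    replace hdb' : ∀ v ∈ W, db b v = G.dist v b := fun v hv =>
      (hdb' b (by simp) v hv).trans G.dist_comm
    set T := W.filter fun v => da a v + db b v = G.dist a b with hT
    have hTW : ∀ v ∈ T, v ∈ W ∧ G.dist a v + G.dist v b = G.dist a b := fun v hv => by
      rw [hT, Finset.mem_filter] at hv
      rw [← hda' v hv.1, ← hdb' v hv.1]
      exact hv
    have hWT : ∀ v, G.dist a v + G.dist v b = G.dist a b → v ≠ a → v ≠ b → v ∈ T :=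
      fun v hv h1 h2 => by
        have hvW := hW v hv h1 h2
        rw [hT, Finset.mem_filter, hda' v hvW, hdb' v hvW]
        exact ⟨hvW, hv⟩
    have hex : ∃ c ∈ T, da a c = G.dist a b / 2 := by
      obtain ⟨p, hp⟩ := hc.exists_walk_length_eq_dist a b
      have hd := dist_add_dist_of_mem_support p hp (p.getVert_mem_support (G.dist a b / 2))
      have h1 := SimpleGraph.dist_le (p.take (G.dist a b / 2))
      have h2 := SimpleGraph.dist_le (p.drop (G.dist a b / 2))
      rw [SimpleGraph.Walk.take_length] at h1
      rw [SimpleGraph.Walk.drop_length] at h2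
      have hcT := hWT _ hd (fun h => by rw [h, SimpleGraph.dist_self] at hd; rw [h] at h2; omega)
        (fun h => by rw [h] at h1; omega)
      refine ⟨_, hcT, ?_⟩
      rw [hda' _ (hTW _ hcT).1]
      omega
    obtain ⟨hcT, hcd⟩ := hex.choose_spec
    set c := hex.choose with hcdef
    obtain ⟨hcW, hcd2⟩ := hTW c hcT
    rw [hda' c hcW] at hcd
    have hT₁ : ∀ v ∈ T, v ∈ T.filter (fun v => da a v < G.dist a b / 2) ↔
        G.dist a v < G.dist a b / 2 := fun v hv => by
      rw [Finset.mem_filter, hda' v (hTW v hv).1]; exact and_iff_right hv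
    have hT₂ : ∀ v ∈ T, v ∈ T.filter (fun v => G.dist a b / 2 < da a v) ↔
        G.dist a b / 2 < G.dist a v := fun v hv => by
      rw [Finset.mem_filter, hda' v (hTW v hv).1]; exact and_iff_right hv
    have hcard : (T.filter (fun v => da a v < G.dist a b / 2)).card +
        (T.filter (fun v => G.dist a b / 2 < da a v)).card + 1 ≤ W.card := by
      rw [← Finset.card_union_of_disjoint (Finset.disjoint_filter.2 fun v _ h h' => by omega)]
      have hlt : T.filter (fun v => da a v < G.dist a b / 2) ∪
          T.filter (fun v => G.dist a b / 2 < da a v) ⊂ W := by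
        refine (Finset.ssubset_iff_of_subset ?_).2 ⟨c, hcW, ?_⟩
        · exact (Finset.union_subset (Finset.filter_subset _ _) (Finset.filter_subset _ _)).trans
            (Finset.filter_subset _ _)
        · rw [Finset.mem_union, hT₁ c hcT, hT₂ c hcT]
          omega
      exact Finset.card_lt_card hlt
    have htri := fun u v w => hc.dist_triangle (u := u) (v := v) (w := w)
    obtain ⟨p₁, q₁, hp₁, hr₁, hq₁⟩ := ih _ (by omega)
      (T.filter (fun v => da a v < G.dist a b / 2)) a c (fun v hv h1 h2 => by
        have h3 : G.dist v c ≠ 0 := fun h => h2 (hc.dist_eq_zero_iff.1 h)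
        have h4 := htri a v b
        have h5 := htri v c b
        refine (hT₁ v (hWT v (by omega) h1 ?_)).2 (by omega)
        rintro rfl
        omega) rfl
    obtain ⟨p₂, q₂, hp₂, hr₂, hq₂⟩ := ih _ (by omega)
      (T.filter (fun v => G.dist a b / 2 < da a v)) c b (fun v hv h1 h2 => by
        have h3 : G.dist c v ≠ 0 := fun h => h1 (hc.dist_eq_zero_iff.1 h).symm
        have h4 := htri a v b
        have h5 := htri a c v
        refine (hT₂ v (hWT v (by omega) ?_ h2)).2 (by omega)
        rintro rfl
        rw [SimpleGraph.dist_self] at h5 h4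
        omega) rfl
    refine ⟨p₁.append p₂, 1 + ({a} : Finset V).card * W.card + ({b} : Finset V).card * W.card +
      (q₁ + q₂), ?_, ?_, ?_⟩
    · rw [SimpleGraph.Walk.length_append, hp₁, hp₂, hcd2]
    · rw [shortestPath, SimpleGraph.Walk.support_append]
      rw [show 1 + ({a} : Finset V).card * W.card + ({b} : Finset V).card * W.card + (q₁ + q₂) =
        1 + (({a} : Finset V).card * W.card + (({b} : Finset V).card * W.card +
          (q₁ + (q₂ + 0)))) by ring]
      refine (runs_query a b).bind ?_
      rw [if_pos hD]
      refine hda.bind (hdb.bind ?_)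
      change Runs _ (dite (∃ c ∈ T, da a c = G.dist a b / 2) _ _) _ _
      rw [dif_pos hex]
      exact hr₁.bind (hr₂.bind (runs_pure _))
    · rw [hcd] at hq₁
      rw [show G.dist c b = G.dist a b - G.dist a b / 2 by omega] at hq₂
      -- The larger half, rounded up, controls the depth; `Nat.clog` drops by exactly one on it.
      have hcl : Nat.clog 2 (G.dist a b) = Nat.clog 2 (G.dist a b - G.dist a b / 2) + 1 := by
        rw [Nat.clog_of_two_le one_lt_two hD]
        congr 2
        omega
      have hcl' : Nat.clog 2 (G.dist a b / 2) ≤ Nat.clog 2 (G.dist a b - G.dist a b / 2) :=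
        Nat.clog_mono_right _ (by omega)
      rw [hcl, ← hn]
      simp only [Finset.card_singleton, one_mul]
      have h1 := Nat.mul_le_mul_left (2 * (T.filter (fun v => da a v < G.dist a b / 2)).card) hcl'
      have h2 := Nat.mul_le_mul_right (Nat.clog 2 (G.dist a b - G.dist a b / 2))
        (Nat.mul_le_mul_left 2 ((Nat.le_succ _).trans hcard))
      rw [mul_add, add_mul] at h2
      rw [mul_add, mul_one]
      omega
  · by_cases hab : a = b
    · subst hab
      refine ⟨SimpleGraph.Walk.nil, 1, by simp, ?_, ?_⟩
      · rw [shortestPath]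
        refine (runs_query a a).bind (r := 0) ?_
        rw [if_neg hD, if_pos rfl]
        exact runs_pure _
      · simp
    · have h0 : G.dist a b ≠ 0 := fun h => hab (hc.dist_eq_zero_iff.1 h)
      have h1 : G.dist a b = 1 := by omega
      refine ⟨(SimpleGraph.dist_eq_one_iff_adj.1 h1).toWalk, 1, by simp [h1], ?_, ?_⟩
      · rw [shortestPath]
        refine (runs_query a b).bind (r := 0) ?_
        rw [if_neg hD, if_neg hab]
        exact runs_pure _
      · simp [h1]

end Deterministic

/-! ### Testing the cliques at a vertex -/

section Round

variable {V : Type} [DecidableEq V] {G : SimpleGraph V}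

variable (G) in
/-- A clique of `U` all of whose parts have less than `β |U|` vertices. -/
def BalancedClique (Δ : ℕ) (U K : Finset V) : Prop :=
  K ⊆ U ∧ K.Nonempty ∧ (∀ s ∈ K, ∀ t ∈ K, G.dist s t ≤ 1) ∧
    ∀ P ∈ parts G U K, (P.card : ℝ) < balance Δ * (U.card : ℝ)

theorem runs_firstBalanced (Δ : ℕ) (U : Finset V) (c : ℕ) (l : List (Finset V))
    (hl : ∀ K ∈ l, K.card * U.card +
      (U.filter fun v => ∃ s ∈ K, G.dist s v ≤ 1).card * U.card ≤ c) :
    ∃ o q, Runs G.dist (firstBalanced Δ U l) o q ∧ q ≤ l.length * c ∧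
      (∀ K ∈ o, K ∈ l ∧ ∀ P ∈ parts G U K, (P.card : ℝ) < balance Δ * (U.card : ℝ)) ∧
      ((∃ K ∈ l, ∀ P ∈ parts G U K, (P.card : ℝ) < balance Δ * (U.card : ℝ)) → o ≠ none) := by
  induction l with
  | nil => exact ⟨none, 0, runs_pure _, by simp, by simp, by simp⟩
  | cons K l ih =>
    obtain ⟨o, q, hr, hq, ho, ho'⟩ := ih fun K' hK' => hl K' (List.mem_cons_of_mem _ hK')
    have hK := hl K List.mem_cons_self
    by_cases hbal : ∀ P ∈ parts G U K, (P.card : ℝ) < balance Δ * (U.card : ℝ)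
    · refine ⟨some K, _, (runs_partition U K).bind (r := 0) ?_, ?_, ?_, by simp⟩
      · rw [if_pos hbal]
        exact runs_pure _
      · rw [List.length_cons, add_mul]
        omega
      · intro K' hK'
        rw [Option.mem_some_iff] at hK'
        exact hK' ▸ ⟨List.mem_cons_self, hbal⟩
    · refine ⟨o, _, (runs_partition U K).bind (r := q) ?_, ?_,
        fun K' hK' => ⟨List.mem_cons_of_mem _ (ho K' hK').1, (ho K' hK').2⟩, ?_⟩
      · rw [if_neg hbal]
        exact hr
      · rw [List.length_cons, add_mul]
        omega
      · rintro ⟨K', hK', hbal'⟩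
        rcases List.mem_cons.1 hK' with rfl | hK'
        · exact absurd hbal' hbal
        · exact ho' ⟨K', hK', hbal'⟩

/-- The part of a round of the search for a separator that follows the choice of the vertex `x`. -/
noncomputable def testCliques (Δ : ℕ) (U : Finset V) (x : V) : OracleProg V (Option (Finset V)) := do
  let d ← querySets {x} U
  let N := U.filter fun v => d x v ≤ 1
  let e ← querySets N N
  let cliques := N.powerset.filter fun K => x ∈ K ∧ ∀ u ∈ K, ∀ v ∈ K, e u v ≤ 1
  firstBalanced Δ U cliques.toList

theorem separatorRound_eq (Δ : ℕ) (U : Finset V) (hU : U.Nonempty) :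
    separatorRound Δ U hU = samplePaths U hU (numSamples Δ U) >>= fun paths =>
      testCliques Δ U (U.exists_max_image (fun v : V => paths.countP fun P => v ∈ P) hU).choose :=
  rfl

theorem partition_cost_le [Fintype V] [DecidableRel G.Adj] (hc : G.Connected) (U : Finset V)
    {K : Finset V} (hK : ∀ s ∈ K, ∀ t ∈ K, G.dist s t ≤ 1) :
    K.card * U.card + (U.filter fun v => ∃ s ∈ K, G.dist s v ≤ 1).card * U.card ≤
      2 * (G.maxDegree + 1) ^ 2 * U.card := by
  rw [← add_mul]
  refine Nat.mul_le_mul_right _ ?_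
  have h1 := card_clique_le hc hK
  have h2 := card_filter_near_le hc U K
  nlinarith

theorem runs_testCliques (Δ : ℕ) (U : Finset V) (x : V) {D c : ℕ}
    (hD : (U.filter fun v => G.dist x v ≤ 1).card ≤ D)
    (hcost : ∀ K : Finset V, (∀ s ∈ K, ∀ t ∈ K, G.dist s t ≤ 1) → K.card * U.card +
      (U.filter fun v => ∃ s ∈ K, G.dist s v ≤ 1).card * U.card ≤ c) :
    ∃ o q, Runs G.dist (testCliques Δ U x) o q ∧ q ≤ U.card + D ^ 2 + 2 ^ D * c ∧
      (∀ K ∈ o, BalancedClique G Δ U K) ∧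
      ((∃ K, x ∈ K ∧ BalancedClique G Δ U K) → o ≠ none) := by
  obtain ⟨d, hd, hd'⟩ := runs_querySets G.dist {x} U
  set N := U.filter fun v => d x v ≤ 1 with hN
  have hN' : N = U.filter fun v => G.dist x v ≤ 1 :=
    Finset.filter_congr fun v hv => by rw [hd' x (by simp) v hv]
  have hNcard : N.card ≤ D := hN' ▸ hD
  obtain ⟨e, he, he'⟩ := runs_querySets G.dist N N
  have hmem : ∀ K, K ∈ N.powerset.filter (fun K => x ∈ K ∧ ∀ u ∈ K, ∀ v ∈ K, e u v ≤ 1) ↔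
      K ⊆ U ∧ x ∈ K ∧ ∀ u ∈ K, ∀ v ∈ K, G.dist u v ≤ 1 := by
    intro K
    rw [Finset.mem_filter, Finset.mem_powerset]
    constructor
    · rintro ⟨hKN, hxK, hcl⟩
      refine ⟨hKN.trans (Finset.filter_subset _ _), hxK, fun u hu v hv => ?_⟩
      rw [← he' u (hKN hu) v (hKN hv)]
      exact hcl u hu v hv
    · rintro ⟨hKU, hxK, hcl⟩
      have hKN : K ⊆ N := fun v hv => hN' ▸ Finset.mem_filter.2 ⟨hKU hv, hcl x hxK v hv⟩
      refine ⟨hKN, hxK, fun u hu v hv => ?_⟩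
      rw [he' u (hKN hu) v (hKN hv)]
      exact hcl u hu v hv
  obtain ⟨o, q, hr, hq, ho, ho'⟩ := runs_firstBalanced (G := G) Δ U c
    (N.powerset.filter fun K => x ∈ K ∧ ∀ u ∈ K, ∀ v ∈ K, e u v ≤ 1).toList
    (fun K hK => hcost K ((hmem K).1 (Finset.mem_toList.1 hK)).2.2)
  refine ⟨o, _, hd.bind (he.bind hr), ?_, ?_, ?_⟩
  · rw [Finset.length_toList] at hq
    have h1 : (N.powerset.filter fun K => x ∈ K ∧ ∀ u ∈ K, ∀ v ∈ K, e u v ≤ 1).card ≤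
        2 ^ D :=
      (Finset.card_filter_le _ _).trans
        ((Finset.card_powerset N).trans_le (Nat.pow_le_pow_right two_pos hNcard))
    have h2 := Nat.mul_le_mul_right c h1
    have h3 := Nat.mul_le_mul hNcard hNcard
    rw [← sq D] at h3
    simp only [Finset.card_singleton, one_mul]
    omega
  · intro K hK
    obtain ⟨hK1, hK2⟩ := ho K hK
    obtain ⟨h1, h2, h3⟩ := (hmem K).1 (Finset.mem_toList.1 hK1)
    exact ⟨h1, ⟨x, h2⟩, h3, hK2⟩
  · rintro ⟨K, hxK, hKU, -, hcl, hbal⟩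
    exact ho' ⟨K, Finset.mem_toList.2 ((hmem K).2 ⟨hKU, hxK, hcl⟩), hbal⟩

theorem one_sub_le_balance_sq (Δ : ℕ) : 1 - 1 / (4 * ((Δ : ℝ) + 1)) ≤ balance Δ ^ 2 := by
  have h0 : 0 ≤ 1 - 1 / (4 * ((Δ : ℝ) + 1)) := by
    rw [sub_nonneg, div_le_one (by positivity)]
    have : (0 : ℝ) ≤ Δ := Nat.cast_nonneg _
    linarith
  calc _ = Real.sqrt (1 - 1 / (4 * ((Δ : ℝ) + 1))) ^ 2 := (Real.sq_sqrt h0).symm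
    _ ≤ _ := pow_le_pow_left₀ (Real.sqrt_nonneg _) (le_max_right _ _) 2

/-- A part that violates the balance condition therefore has more than half of the vertices, as the
descent through cliques requires. -/
theorem half_lt_balance (Δ : ℕ) : 1 / 2 < balance Δ := by
  refine lt_of_lt_of_le ((Real.lt_sqrt (by norm_num)).2 ?_) (le_max_right _ _)
  have : 1 / (4 * ((Δ : ℝ) + 1)) ≤ 1 / 4 := by
    apply one_div_le_one_div_of_le (by norm_num)
    have : (0 : ℝ) ≤ Δ := Nat.cast_nonneg _
    linarith
  linarith

/-- A vertex that is in no balanced clique is on few shortest paths. -/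
theorem few_paths_of_not_balancedClique (hc : G.Connected) (hG : G.IsChordal) {Δ : ℕ}
    {U : Finset V} (hU : GeodClosed G U) {x : V} (hx : x ∈ U)
    (hno : ¬ ∃ K, x ∈ K ∧ BalancedClique G Δ U K) (path : V → V → List V)
    (hpath : ∀ a ∈ U, ∀ b ∈ U, ∃ p : G.Walk a b, p.length = G.dist a b ∧ path a b = p.support) :
    4 * (Δ + 1) * ((U ×ˢ U).filter fun q => x ∈ path q.1 q.2).card ≤ U.card ^ 2 := by
  have hm : (0 : ℝ) < U.card := Nat.cast_pos.2 (Finset.card_pos.2 ⟨x, hx⟩)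
  rcases exists_clique_or_avoiding hc hG hU
    (big := fun k => ¬ (k : ℝ) < balance Δ * (U.card : ℝ)) (fun k hk => by
      have h := half_lt_balance Δ
      have : (U.card : ℝ) < 2 * k := by nlinarith [not_lt.1 hk]
      exact_mod_cast this) hx with
    ⟨K, hKU, hxK, hcl, hbal⟩ | ⟨A, hAU, hA, hav⟩
  · exact absurd ⟨K, hxK, hKU, ⟨x, hxK⟩, hcl, fun P hP => not_not.1 (hbal P hP)⟩ hno
  · rw [not_lt] at hA
    -- No path between two vertices of `A` contains `x`, so at most `(1 - β²)|U|²` pairs remain.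
    have hdisj : Disjoint ((U ×ˢ U).filter fun q => x ∈ path q.1 q.2) (A ×ˢ A) := by
      rw [Finset.disjoint_left]
      rintro ⟨a, b⟩ hab hab'
      rw [Finset.mem_product] at hab'
      obtain ⟨p, hp, hpe⟩ := hpath a (hAU hab'.1) b (hAU hab'.2)
      have hx' := (Finset.mem_filter.1 hab).2
      simp only [hpe] at hx'
      exact hav a hab'.1 b hab'.2 (dist_add_dist_of_mem_support p hp hx')
    have h1 := Finset.card_le_card (Finset.union_subset
      (Finset.filter_subset (fun q => x ∈ path q.1 q.2) (U ×ˢ U)) (Finset.product_subset_product hAU hAU))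
    rw [Finset.card_union_of_disjoint hdisj, Finset.card_product, Finset.card_product] at h1
    set N := ((U ×ˢ U).filter fun q => x ∈ path q.1 q.2).card
    have h2 : (N : ℝ) + A.card * A.card ≤ U.card * U.card := by exact_mod_cast h1
    have h3 := one_sub_le_balance_sq Δ
    have h4 : (balance Δ * U.card) ^ 2 ≤ (A.card : ℝ) ^ 2 :=
      pow_le_pow_left₀ (mul_nonneg (by linarith [half_lt_balance Δ]) hm.le) hA 2
    have h5 : (N : ℝ) ≤ 1 / (4 * ((Δ : ℝ) + 1)) * U.card ^ 2 := by
      nlinarith [mul_le_mul_of_nonneg_right h3 (sq_nonneg (U.card : ℝ))]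
    have h6 : (4 * ((Δ : ℝ) + 1)) * N ≤ (U.card : ℝ) ^ 2 := by
      have hpos : 0 < 4 * ((Δ : ℝ) + 1) := by positivity
      have := mul_le_mul_of_nonneg_left h5 hpos.le
      rwa [← mul_assoc, mul_one_div_cancel hpos.ne', one_mul] at this
    exact_mod_cast h6

end Round

end ChordalReconstruction

/-! ### Exponential moments of the sampled paths -/

namespace OracleProg

theorem expect_zero {V α : Type} {δ : V → V → ℕ} (p : OracleProg V α) :
    p.expect δ (fun _ _ => 0) = 0 :=
  le_antisymm (expect_const_le p 0) zero_le

theorem expect_sum_le {V α ι : Type} {δ : V → V → ℕ} (p : OracleProg V α) (s : Finset ι)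
    (f : ι → α → ℕ → ℝ≥0∞) :
    p.expect δ (fun a q => ∑ i ∈ s, f i a q) ≤ ∑ i ∈ s, p.expect δ (f i) := by
  classical
  induction s using Finset.induction_on with
  | empty => simp [expect_zero]
  | insert i s hi ih =>
    simp only [Finset.sum_insert hi]
    exact (expect_add_le p _ _).trans (add_le_add le_rfl ih)

end OracleProg

namespace ChordalReconstruction
open OracleProg hiding pure bind

/-- As `256 = 4 · 64`, the power is at most `|U|⁻⁴`; the union bound over `|U|` vertices leaves
`|U|⁻³ ≤ 1/8`. -/
theorem pow_numSamples_le {V : Type} {U : Finset V} (Δ : ℕ) (hU : 2 ≤ U.card) :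
    (U.card : ℝ≥0∞) *
      ENNReal.ofReal (Real.exp (-(1 / (64 * ((Δ + 1 : ℕ) : ℝ) ^ 2)))) ^ numSamples Δ U ≤ 1 / 2 := by
  have hm : (2 : ℝ) ≤ U.card := by exact_mod_cast hU
  have hm0 : (0 : ℝ) < U.card := by linarith
  rw [← ENNReal.ofReal_pow (Real.exp_pos _).le, ← Real.exp_nat_mul, ← ENNReal.ofReal_natCast,
    ← ENNReal.ofReal_mul hm0.le,
    show (1 / 2 : ℝ≥0∞) = ENNReal.ofReal (1 / 2) by
      rw [ENNReal.ofReal_div_of_pos (by norm_num)]; simp]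
  refine ENNReal.ofReal_le_ofReal ?_
  have h1 : 256 * ((Δ : ℝ) + 1) ^ 2 * Real.log U.card ≤ numSamples Δ U := Nat.le_ceil _
  have h2 : (numSamples Δ U : ℝ) * -(1 / (64 * ((Δ + 1 : ℕ) : ℝ) ^ 2)) ≤
      -(4 * Real.log U.card) := by
    have hpos : 0 < 1 / (64 * ((Δ + 1 : ℕ) : ℝ) ^ 2) := by positivity
    have h3 := mul_le_mul_of_nonneg_right h1 hpos.le
    have h4 : 256 * ((Δ : ℝ) + 1) ^ 2 * Real.log U.card * (1 / (64 * ((Δ + 1 : ℕ) : ℝ) ^ 2)) =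
        4 * Real.log U.card := by
      push_cast
      field_simp
      ring
    linarith
  calc (U.card : ℝ) * Real.exp _ ≤ U.card * Real.exp (-(4 * Real.log U.card)) := by gcongr
    _ = U.card * ((U.card : ℝ) ^ 4)⁻¹ := by
        rw [Real.exp_neg, show 4 * Real.log (U.card : ℝ) = Real.log ((U.card : ℝ) ^ 4) by
          rw [Real.log_pow]; norm_num, Real.exp_log (by positivity)]
    _ = ((U.card : ℝ) ^ 3)⁻¹ := by field_simp
    _ ≤ ((2 : ℝ) ^ 3)⁻¹ := by gcongr
    _ ≤ 1 / 2 := by norm_num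

section Samples

variable {V : Type} [DecidableEq V] {G : SimpleGraph V}

/-- Each shortest-path call has a deterministic outcome, so the sample depends on the random pairs
alone. The vertices of a geodesic are distinct and lie in `U`, so the distance is below `|U|`. -/
theorem exists_path_function (hc : G.Connected) {U : Finset V} (hU : GeodClosed G U) :
    ∃ (path : V → V → List V) (cost : V → V → ℕ), ∀ a ∈ U, ∀ b ∈ U,
      Runs G.dist (shortestPath U a b) (path a b) (cost a b) ∧
      cost a b ≤ 2 * U.card * Nat.clog 2 U.card + 2 * U.card ∧
      ∃ p : G.Walk a b, p.length = G.dist a b ∧ path a b = p.support := by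
  have h : ∀ a b, ∃ (l : List V) (q : ℕ), a ∈ U → b ∈ U →
      Runs G.dist (shortestPath U a b) l q ∧ q ≤ 2 * U.card * Nat.clog 2 U.card + 2 * U.card ∧
      ∃ p : G.Walk a b, p.length = G.dist a b ∧ l = p.support := by
    intro a b
    by_cases hab : a ∈ U ∧ b ∈ U
    · obtain ⟨p, q, hp, hr, hq⟩ := runs_shortestPath hc U a b fun v hv _ _ => hU a hab.1 b hab.2 v hv
      refine ⟨p.support, q, fun _ _ => ⟨hr, ?_, p, hp, rfl⟩⟩
      have hd : G.dist a b + 1 ≤ U.card := by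
        have hnd := (p.isPath_of_length_eq_dist hp).support_nodup
        have h1 : p.support.toFinset.card = G.dist a b + 1 := by
          rw [List.toFinset_card_of_nodup hnd, SimpleGraph.Walk.length_support, hp]
        rw [← h1]
        exact Finset.card_le_card fun v hv => hU a hab.1 b hab.2 v
          (dist_add_dist_of_mem_support p hp (List.mem_toFinset.1 hv))
      have h1 : Nat.clog 2 (G.dist a b) ≤ Nat.clog 2 U.card := Nat.clog_mono_right _ (by omega)
      have h2 := Nat.mul_le_mul_left (2 * U.card) h1
      have h3 : max (G.dist a b) 1 ≤ U.card := by omega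
      omega
    · exact ⟨[], 0, fun ha hb => absurd ⟨ha, hb⟩ hab⟩
  choose path cost h using h
  exact ⟨path, cost, fun a ha b hb => h a b ha hb⟩

variable {δ : V → V → ℕ} {U : Finset V} {path : V → V → List V} {cost : V → V → ℕ}

theorem expect_samplePaths_succ (hU : U.Nonempty)
    (hr : ∀ a ∈ U, ∀ b ∈ U, Runs δ (shortestPath U a b) (path a b) (cost a b)) (k : ℕ)
    (f : List (List V) → ℕ → ℝ≥0∞) :
    (samplePaths U hU (k + 1)).expect δ f =
      (∑ a ∈ U, (∑ b ∈ U, (samplePaths U hU k).expect δ fun l q =>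
        f (path a b :: l) (cost a b + q)) / U.card) / U.card := by
  change (uniform U hU >>= fun a => uniform U hU >>= fun b => shortestPath U a b >>= fun P =>
    samplePaths U hU k >>= fun rest => (pure (P :: rest) : OracleProg V _)).expect δ f = _
  rw [expect_bind, expect_uniform]
  congr 1
  refine Finset.sum_congr rfl fun a ha => ?_
  rw [expect_bind, expect_uniform]
  congr 1
  refine Finset.sum_congr rfl fun b hb => ?_
  rw [expect_bind, hr a ha b hb, expect_bind]
  congr 1
  funext l q
  rw [expect_pure]
  simp

theorem almostSurely_samplePaths (hU : U.Nonempty)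
    (hr : ∀ a ∈ U, ∀ b ∈ U, Runs δ (shortestPath U a b) (path a b) (cost a b)) {c : ℕ}
    (hcost : ∀ a ∈ U, ∀ b ∈ U, cost a b ≤ c) (k : ℕ) :
    AlmostSurely δ (samplePaths U hU k) fun _ q => q ≤ k * c := by
  induction k with
  | zero => exact (runs_pure _).almostSurely (by simp)
  | succ k ih =>
    intro f g hfg
    rw [expect_samplePaths_succ hU hr, expect_samplePaths_succ hU hr]
    refine ENNReal.div_le_div_right (Finset.sum_le_sum fun a ha => ?_) _
    refine ENNReal.div_le_div_right (Finset.sum_le_sum fun b hb => ?_) _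
    refine ih _ _ fun l q hq => hfg _ _ ?_
    have := hcost a ha b hb
    rw [add_mul]
    omega

theorem samplePaths_halts (hU : U.Nonempty)
    (hr : ∀ a ∈ U, ∀ b ∈ U, Runs δ (shortestPath U a b) (path a b) (cost a b)) (k : ℕ) :
    (samplePaths U hU k).expect δ (fun _ _ => 1) = 1 := by
  have hm : (U.card : ℝ≥0∞) ≠ 0 := by simpa using hU.ne_empty
  induction k with
  | zero => rfl
  | succ k ih =>
    rw [expect_samplePaths_succ hU hr]
    simp only [ih]
    simp [ENNReal.div_self hm (ENNReal.natCast_ne_top _)]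

/-- Independence: the mean of a product of weights is bounded by the power of the mean of one
weight. -/
theorem expect_samplePaths_prod_le (hU : U.Nonempty)
    (hr : ∀ a ∈ U, ∀ b ∈ U, Runs δ (shortestPath U a b) (path a b) (cost a b))
    (w : List V → ℝ≥0∞) {ρ : ℝ≥0∞}
    (hw : ∑ a ∈ U, ∑ b ∈ U, w (path a b) ≤ ρ * U.card ^ 2) (k : ℕ) :
    (samplePaths U hU k).expect δ (fun l _ => (l.map w).prod) ≤ ρ ^ k := by
  have hm : (U.card : ℝ≥0∞) ≠ 0 := by simpa using hU.ne_empty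
  have hm' : (U.card : ℝ≥0∞) ≠ ∞ := ENNReal.natCast_ne_top _
  induction k with
  | zero => exact le_of_eq (by rw [samplePaths, expect_pure]; simp)
  | succ k ih =>
    rw [expect_samplePaths_succ hU hr]
    simp only [List.map_cons, List.prod_cons]
    calc _ ≤ (∑ a ∈ U, (∑ b ∈ U, w (path a b) * ρ ^ k) / U.card) / (U.card : ℝ≥0∞) := by
          gcongr with a ha b hb
          exact (expect_mul_le _ _ _).trans (mul_le_mul_right ih _)
      _ = (∑ a ∈ U, ∑ b ∈ U, w (path a b)) * ρ ^ k / U.card / U.card := by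
          simp only [div_eq_mul_inv, Finset.sum_mul]
      _ ≤ ρ * U.card ^ 2 * ρ ^ k / U.card / U.card := by gcongr
      _ = ρ ^ (k + 1) := by
          rw [show ρ * (U.card : ℝ≥0∞) ^ 2 * ρ ^ k = ρ ^ (k + 1) * U.card * U.card by ring,
            ENNReal.mul_div_cancel_right hm hm', ENNReal.mul_div_cancel_right hm hm']

/-- The ratio of the weights of the paths through `x` and through `z`. -/
noncomputable def comparisonWeight (r : ℝ) (x z : V) (P : List V) : ℝ≥0∞ :=
  ENNReal.ofReal (Real.exp (r * ((if x ∈ P then 1 else 0) - (if z ∈ P then 1 else 0))))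

theorem prod_comparisonWeight (r : ℝ) (x z : V) (l : List (List V)) :
    (l.map (comparisonWeight r x z)).prod =
      ENNReal.ofReal (Real.exp (r * ((l.countP fun P => x ∈ P : ℕ) -
        (l.countP fun P => z ∈ P : ℕ)))) := by
  induction l with
  | nil => simp
  | cons P l ih =>
    rw [List.map_cons, List.prod_cons, ih, comparisonWeight,
      ← ENNReal.ofReal_mul (Real.exp_pos _).le, ← Real.exp_add]
    congr 2
    simp only [List.countP_cons, decide_eq_true_eq, Nat.cast_add, Nat.cast_ite, Nat.cast_one,
      Nat.cast_zero]
    ring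

/-- By `exp v ≤ 1 + v + v²` for `|v| ≤ 1`, the mean weight is at most `1 + r² + r (X - Z)/|U|²`,
where the last quotient is at most `1/(4D) - 1/(2D) = -1/(4D)`. The choice `r = 1/(8D)` minimises
this and gives `1 - 1/(64D²)`. -/
theorem sum_comparisonWeight_le {D : ℕ} (hD : 0 < D) {x z : V}
    (hx : 4 * D * ((U ×ˢ U).filter fun q => x ∈ path q.1 q.2).card ≤ U.card ^ 2)
    (hz : U.card ^ 2 ≤ 2 * D * ((U ×ˢ U).filter fun q => z ∈ path q.1 q.2).card) :
    ∑ a ∈ U, ∑ b ∈ U, comparisonWeight (1 / (8 * D)) x z (path a b) ≤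
      ENNReal.ofReal (Real.exp (-(1 / (64 * (D : ℝ) ^ 2)))) * U.card ^ 2 := by
  have hD' : (1 : ℝ) ≤ D := by exact_mod_cast hD
  rw [← Finset.sum_product' (f := fun a b => comparisonWeight (1 / (8 * D)) x z (path a b))]
  unfold comparisonWeight
  rw [← ENNReal.ofReal_sum_of_nonneg fun _ _ => (Real.exp_pos _).le,
    show (U.card : ℝ≥0∞) ^ 2 = ENNReal.ofReal ((U.card : ℝ) ^ 2) by
      rw [ENNReal.ofReal_pow (Nat.cast_nonneg _), ENNReal.ofReal_natCast],
    ← ENNReal.ofReal_mul (Real.exp_pos _).le]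
  refine ENNReal.ofReal_le_ofReal ?_
  set r : ℝ := 1 / (8 * D) with hr
  have hr0 : 0 ≤ r := by positivity
  have hr1 : r ≤ 1 := by rw [hr, div_le_one (by positivity)]; linarith
  set X := ((U ×ˢ U).filter fun q => x ∈ path q.1 q.2).card with hX
  set Z := ((U ×ˢ U).filter fun q => z ∈ path q.1 q.2).card with hZ
  calc _ ≤ ∑ q ∈ U ×ˢ U, ((1 + r ^ 2) + r * ((if x ∈ path q.1 q.2 then 1 else 0) -
          (if z ∈ path q.1 q.2 then 1 else 0))) := by
        refine Finset.sum_le_sum fun q _ => ?_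
        generalize hu : ((if x ∈ path q.1 q.2 then 1 else 0) -
          (if z ∈ path q.1 q.2 then 1 else 0) : ℝ) = u
        have hu1 : |u| ≤ 1 := by rw [← hu]; split_ifs <;> norm_num
        have h1 : |r * u| ≤ 1 := by
          rw [abs_mul, abs_of_nonneg hr0]
          exact mul_le_one₀ hr1 (abs_nonneg _) hu1
        have h2 := (abs_le.1 (Real.abs_exp_sub_one_sub_id_le h1)).2
        have h3 : (r * u) ^ 2 ≤ r ^ 2 := by
          rw [mul_pow]
          exact mul_le_of_le_one_right (sq_nonneg _) ((sq_le_one_iff_abs_le_one u).2 hu1)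
        linarith
    _ = (1 + r ^ 2) * U.card ^ 2 + r * (X - Z) := by
        rw [Finset.sum_add_distrib, ← Finset.mul_sum, Finset.sum_sub_distrib, Finset.sum_boole,
          Finset.sum_boole, Finset.sum_const, Finset.card_product, nsmul_eq_mul]
        push_cast
        ring
    _ ≤ (1 - 1 / (64 * (D : ℝ) ^ 2)) * U.card ^ 2 := by
        have hx' : 4 * (D : ℝ) * X ≤ U.card ^ 2 := by exact_mod_cast hx
        have hz' : (U.card : ℝ) ^ 2 ≤ 2 * D * Z := by exact_mod_cast hz
        have h1 : (D : ℝ) * r = 1 / 8 := by rw [hr]; field_simp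
        have h2 : 1 / (64 * (D : ℝ) ^ 2) = r ^ 2 := by rw [hr]; field_simp; norm_num
        rw [h2]
        have h3 : r * (X - Z) = r ^ 2 * (8 * D * (X - Z)) := by
          linear_combination (-8 * r * (X - Z)) * h1
        rw [h3]
        nlinarith [sq_nonneg r]
    _ ≤ _ := by
        gcongr
        have := Real.add_one_le_exp (-(1 / (64 * (D : ℝ) ^ 2)))
        linarith

end Samples

/-! ### Success probability of a round -/

section RoundSpec

variable {V : Type} [DecidableEq V] {G : SimpleGraph V}

/-- A round of the search for a separator costs few queries and succeeds with probability at least one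
half. -/
theorem separatorRound_spec [Fintype V] [DecidableRel G.Adj] (hc : G.Connected) (hG : G.IsChordal)
    {U : Finset V} (hU : GeodClosed G U) (hne : U.Nonempty) (hcard : 2 ≤ U.card) :
    Spec G.dist (separatorRound G.maxDegree U hne)
      (fun o => ∀ K ∈ o, BalancedClique G G.maxDegree U K)
      ((numSamples G.maxDegree U * (2 * U.card * Nat.clog 2 U.card + 2 * U.card) +
        (U.card + (G.maxDegree + 1) ^ 2 +
          2 ^ (G.maxDegree + 1) * (2 * (G.maxDegree + 1) ^ 2 * U.card)) : ℕ) : ℝ≥0∞) ∧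
    (separatorRound G.maxDegree U hne).expect G.dist
      (fun o _ => if o.isNone then 1 else 0) ≤ 1 / 2 := by
  set Δ := G.maxDegree with hΔ
  obtain ⟨path, cost, hpc⟩ := exists_path_function hc hU
  have hr := fun a ha b hb => (hpc a ha b hb).1
  have hcost := fun a ha b hb => (hpc a ha b hb).2.1
  have hpath := fun a ha b hb => (hpc a ha b hb).2.2
  have htest := fun x => runs_testCliques (G := G) Δ U x (card_filter_dist_le_one hc U x)
    fun K hK => partition_cost_le hc U hK
  choose o q ho hq hbal hsome using htest
  have hsamp := almostSurely_samplePaths hne hr hcost (numSamples Δ U)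
  have hexp : ∀ f, (separatorRound Δ U hne).expect G.dist f =
      (samplePaths U hne (numSamples Δ U)).expect G.dist fun paths s =>
        f (o (U.exists_max_image (fun v : V => paths.countP fun P => v ∈ P) hne).choose)
          (s + q (U.exists_max_image (fun v : V => paths.countP fun P => v ∈ P) hne).choose) := by
    intro f
    rw [separatorRound_eq, expect_bind]
    congr 1
    funext paths s
    rw [ho]
  refine ⟨⟨fun f g hfg => ?_, ?_, ?_⟩, ?_⟩
  · rw [hexp, hexp]
    exact expect_mono _ fun paths s => hfg _ _ (hbal _)
  · rw [hexp]
    exact samplePaths_halts hne hr _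
  · rw [hexp]
    refine le_trans (hsamp _ (fun _ _ => _) fun paths s hs => ?_) (expect_const_le _ _)
    rw [Nat.cast_le]
    exact add_le_add hs (hq _)
  · rw [hexp]
    obtain ⟨z, hz, hzheavy⟩ := exists_heavy_vertex hc hG hU hne (D := Δ + 1)
      (fun K hK => card_clique_le hc hK) path hpath
    set light := U.filter fun x =>
      4 * (Δ + 1) * ((U ×ˢ U).filter fun q => x ∈ path q.1 q.2).card ≤ U.card ^ 2 with hlight
    -- If the round fails, the chosen vertex is in no balanced clique, hence light, yet it occurs at
    -- least as often as `z`. Its product of weights is then at least one, so the sum over light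
    -- vertices dominates the indicator of failure.
    refine le_trans (expect_mono _ (g := fun paths _ => ∑ x ∈ light,
      (paths.map (comparisonWeight (1 / (8 * (Δ + 1 : ℕ))) x z)).prod) fun paths s => ?_) ?_
    · split_ifs with hnone
      · generalize hx : (U.exists_max_image (fun v : V => paths.countP fun P => v ∈ P) hne) = hex
          at hnone
        obtain ⟨hxU, hmax⟩ := hex.choose_spec
        have hxl : hex.choose ∈ light := by
          rw [hlight, Finset.mem_filter]
          refine ⟨hxU, few_paths_of_not_balancedClique hc hG hU hxU (fun hK => ?_) path hpath⟩
          exact hsome _ hK (Option.isNone_iff_eq_none.1 hnone)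
        refine le_trans ?_ (Finset.single_le_sum (fun _ _ => zero_le) hxl)
        rw [prod_comparisonWeight, ← ENNReal.ofReal_one]
        refine ENNReal.ofReal_le_ofReal (Real.one_le_exp (mul_nonneg (by positivity) ?_))
        rw [sub_nonneg]
        exact_mod_cast hmax z hz
      · exact zero_le
    · refine (expect_sum_le _ _ _).trans ?_
      refine le_trans ?_ (pow_numSamples_le Δ hcard)
      calc _ ≤ ∑ x ∈ light, ENNReal.ofReal
              (Real.exp (-(1 / (64 * ((Δ + 1 : ℕ) : ℝ) ^ 2)))) ^ numSamples Δ U :=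
            Finset.sum_le_sum fun x hx => expect_samplePaths_prod_le hne hr _
              (sum_comparisonWeight_le Nat.succ_pos' (Finset.mem_filter.1 hx).2 hzheavy) _
        _ ≤ _ := by
            rw [Finset.sum_const, nsmul_eq_mul]
            gcongr
            exact Finset.filter_subset _ _

end RoundSpec

/-! ### The potential function for the recursion -/

section Arithmetic

/-- The square root is treated by `√(1 - 2t) ≤ 1 - t` with `t = 1/(8(Δ+1))`. The constant 3 works
for both terms: `8(Δ+1) ≤ 3Δ2^Δ`, with equality at `Δ = 2`. -/
theorem balance_le {Δ : ℕ} (hΔ : 2 ≤ Δ) : balance Δ ≤ 1 - 1 / (3 * (Δ : ℝ) * 2 ^ Δ) := by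
  have hΔ' : (2 : ℝ) ≤ Δ := by exact_mod_cast hΔ
  have hpow : (4 : ℝ) ≤ 2 ^ Δ := by
    calc (4 : ℝ) = 2 ^ 2 := by norm_num
      _ ≤ _ := pow_le_pow_right₀ (by norm_num) hΔ
  refine max_le ?_ ?_
  · have : 1 / (3 * (Δ : ℝ) * 2 ^ Δ) ≤ 1 / ((Δ : ℝ) * 2 ^ (Δ + 1)) := by
      apply one_div_le_one_div_of_le (by positivity)
      rw [pow_succ]
      nlinarith
    linarith
  · have h1 : Real.sqrt (1 - 1 / (4 * ((Δ : ℝ) + 1))) ≤ 1 - 1 / (8 * ((Δ : ℝ) + 1)) := by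
      have h8 : 1 / (8 * ((Δ : ℝ) + 1)) ≤ 1 := by
        rw [div_le_one (by positivity)]; linarith
      refine Real.sqrt_le_iff.2 ⟨by linarith, ?_⟩
      have : 1 / (4 * ((Δ : ℝ) + 1)) = 2 * (1 / (8 * ((Δ : ℝ) + 1))) := by
        field_simp; norm_num
      rw [this]
      nlinarith [sq_nonneg (1 / (8 * ((Δ : ℝ) + 1)))]
    have h2 : 1 / (3 * (Δ : ℝ) * 2 ^ Δ) ≤ 1 / (8 * ((Δ : ℝ) + 1)) := by
      apply one_div_le_one_div_of_le (by positivity)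
      nlinarith
    linarith

/-- The sets passed to the recursive calls are smaller by a constant factor. -/
theorem card_add_le_of_balanced {Δ m p k : ℕ} (hΔ : 2 ≤ Δ) (hm : threshold Δ < m)
    (hp : (p : ℝ) < balance Δ * m) (hk : k ≤ Δ + 1) :
    ((p + k : ℕ) : ℝ) ≤ (1 - 1 / (12 * (Δ : ℝ) * 2 ^ Δ)) * m := by
  have hΔ' : (2 : ℝ) ≤ Δ := by exact_mod_cast hΔ
  have hm' : (2 : ℝ) ^ (Δ + 2) * ((Δ : ℝ) + 1) ^ 2 ≤ m := by
    have := hm.le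
    unfold threshold at this
    exact_mod_cast this
  have hk' : (k : ℝ) ≤ Δ + 1 := by exact_mod_cast hk
  have hm0 : (0 : ℝ) ≤ m := Nat.cast_nonneg _
  have h1 := mul_le_mul_of_nonneg_right (balance_le hΔ) hm0
  -- The threshold makes the clique small against `m`: of the gain `1/3` in `balance_le`, it uses up
  -- `1/4` and leaves `1/12`.
  have h2 : (Δ : ℝ) + 1 ≤ 1 / (4 * (Δ : ℝ) * 2 ^ Δ) * m := by
    rw [div_mul_eq_mul_div, one_mul, le_div_iff₀ (by positivity)]
    have h3 : (0 : ℝ) < 2 ^ Δ := by positivity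
    calc ((Δ : ℝ) + 1) * (4 * Δ * 2 ^ Δ) ≤ 2 ^ (Δ + 2) * ((Δ : ℝ) + 1) ^ 2 := by
          rw [pow_add]
          nlinarith [mul_pos h3 (by linarith : (0 : ℝ) < Δ + 1)]
      _ ≤ m := hm'
  have h3 : 1 / (3 * (Δ : ℝ) * 2 ^ Δ) = 1 / (4 * (Δ : ℝ) * 2 ^ Δ) + 1 / (12 * (Δ : ℝ) * 2 ^ Δ) := by
    field_simp; norm_num
  rw [h3] at h1
  push_cast
  linarith

theorem clog_two_le {m : ℕ} (hm : 2 ≤ m) (hlog : 1 ≤ Real.log m) :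
    (Nat.clog 2 m : ℝ) ≤ 3 * Real.log m := by
  have h1 := Nat.pow_pred_clog_lt_self one_lt_two (show 1 < m by omega)
  have h2 : ((2 : ℝ) ^ (Nat.clog 2 m).pred) ≤ m := by exact_mod_cast h1.le
  have h3 := Real.log_le_log (by positivity) h2
  rw [Real.log_pow] at h3
  have h4 : (Nat.clog 2 m : ℝ) ≤ (Nat.clog 2 m).pred + 1 := by
    exact_mod_cast Nat.le_succ_of_pred_le le_rfl
  have h5 := Real.log_two_gt_d9
  have h6 : (0 : ℝ) ≤ ((Nat.clog 2 m).pred : ℕ) := Nat.cast_nonneg _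
  nlinarith

theorem one_le_log_of_threshold_lt {Δ m : ℕ} (hm : threshold Δ < m) : 1 ≤ Real.log m := by
  have h1 : 4 ≤ threshold Δ := by
    unfold threshold
    calc 4 = 2 ^ (0 + 2) * 1 := by norm_num
      _ ≤ _ := Nat.mul_le_mul (Nat.pow_le_pow_right two_pos (by omega)) (Nat.one_le_pow _ _ (by omega))
  rw [Real.le_log_iff_exp_le (by exact_mod_cast (by omega : 0 < m))]
  have h2 : (4 : ℝ) ≤ m := by exact_mod_cast h1.trans hm.le
  linarith [Real.exp_one_lt_d9]

/-- The cost of finding and applying a separator. -/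
theorem separator_cost_le {V : Type} {Δ : ℕ} {U : Finset V} {n : ℕ} (hm : threshold Δ < U.card)
    (hn : U.card ≤ n) :
    2 * ((numSamples Δ U * (2 * U.card * Nat.clog 2 U.card + 2 * U.card) +
        (U.card + (Δ + 1) ^ 2 + 2 ^ (Δ + 1) * (2 * (Δ + 1) ^ 2 * U.card)) : ℕ) : ℝ) +
      ((2 * (Δ + 1) ^ 2 * U.card : ℕ) : ℝ) + ((Δ + 1) ^ 2 * U.card : ℕ) ≤
      4112 * ((Δ : ℝ) + 1) ^ 2 * (2 ^ Δ + Real.log n ^ 2) * U.card := by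
  have hlogm := one_le_log_of_threshold_lt hm
  have hm1 : 2 ≤ U.card := by
    by_contra h
    interval_cases U.card <;> norm_num at hlogm
  have hlog : Real.log U.card ≤ Real.log n :=
    Real.log_le_log (by exact_mod_cast (by omega : 0 < U.card)) (by exact_mod_cast hn)
  have hL : 1 ≤ Real.log n := hlogm.trans hlog
  have hclog : (Nat.clog 2 U.card : ℝ) ≤ 3 * Real.log n :=
    (clog_two_le hm1 hlogm).trans (by linarith)
  have hD : (1 : ℝ) ≤ ((Δ : ℝ) + 1) ^ 2 := by
    have : (0 : ℝ) ≤ Δ := Nat.cast_nonneg _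
    nlinarith
  have hk : (numSamples Δ U : ℝ) ≤ 257 * ((Δ : ℝ) + 1) ^ 2 * Real.log n := by
    have h1 : (numSamples Δ U : ℝ) < 256 * ((Δ : ℝ) + 1) ^ 2 * Real.log U.card + 1 :=
      Nat.ceil_lt_add_one (by positivity)
    have h2 : 256 * ((Δ : ℝ) + 1) ^ 2 * Real.log U.card ≤ 256 * ((Δ : ℝ) + 1) ^ 2 * Real.log n := by
      gcongr
    nlinarith
  push_cast
  set L := Real.log n
  set D2 := ((Δ : ℝ) + 1) ^ 2
  have hm2 : (2 : ℝ) ≤ U.card := by exact_mod_cast hm1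
  set m := (U.card : ℝ)
  have hpow : (1 : ℝ) ≤ 2 ^ Δ := one_le_pow₀ (by norm_num)
  rw [pow_succ (2 : ℝ) Δ]
  set p := (2 : ℝ) ^ Δ
  -- The 257 absorbs the ceiling and the 8 comes from `2 · 3 + 2`; doubling for the repeated rounds
  -- gives `4112 = 2 · 257 · 8`. The remaining terms fit under `D2 * p * m`.
  have h1 : (numSamples Δ U : ℝ) * (2 * m * Nat.clog 2 U.card + 2 * m) ≤
      (257 * D2 * L) * (8 * m * L) := by
    refine mul_le_mul hk ?_ (by positivity) (by positivity)
    nlinarith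
  have hDm : m ≤ D2 * m := by nlinarith
  have hDm' : D2 ≤ D2 * m := by nlinarith
  have hDmp : D2 * m ≤ D2 * m * p := by nlinarith
  nlinarith

/-- The bound on the expected number of queries of a call on `m` vertices. -/
noncomputable def queryBound (Δ : ℕ) (q : ℝ) (m : ℕ) : ℝ :=
  ((Δ : ℝ) + 1) ^ 2 +
    ((m - (Δ + 1) : ℕ) : ℝ) * (2 * threshold Δ + 24 * Δ * 2 ^ Δ * q * Real.log m)

theorem queryBound_nonneg (Δ : ℕ) {q : ℝ} (hq : 0 ≤ q) (m : ℕ) : 0 ≤ queryBound Δ q m := by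
  have := Real.log_natCast_nonneg m
  unfold queryBound
  positivity

/-- For `m ≤ Δ + 1` the constant term suffices. Otherwise `m² - (Δ+1)²` factors as `m - (Δ+1)` times
`m + (Δ+1)`, and the second factor is at most twice the threshold. -/
theorem sq_le_queryBound {Δ : ℕ} {q : ℝ} (hq : 0 ≤ q) {m : ℕ} (hm : m ≤ threshold Δ) :
    (m : ℝ) ^ 2 ≤ queryBound Δ q m := by
  have hlog := Real.log_natCast_nonneg m
  have h1 : ((m - (Δ + 1) : ℕ) : ℝ) * (2 * threshold Δ) ≤
      ((m - (Δ + 1) : ℕ) : ℝ) * (2 * threshold Δ + 24 * Δ * 2 ^ Δ * q * Real.log m) := by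
    gcongr
    have : 0 ≤ 24 * Δ * 2 ^ Δ * q * Real.log m := by positivity
    linarith
  have hth : Δ + 1 ≤ threshold Δ := by
    unfold threshold
    calc Δ + 1 ≤ (Δ + 1) ^ 2 := Nat.le_self_pow two_ne_zero _
      _ ≤ _ := Nat.le_mul_of_pos_left _ (by positivity)
  have h2 : m ^ 2 ≤ (Δ + 1) ^ 2 + (m - (Δ + 1)) * (2 * threshold Δ) := by
    rcases le_total m (Δ + 1) with h | h
    · exact (Nat.pow_le_pow_left h 2).trans (Nat.le_add_right _ _)
    · obtain ⟨e, rfl⟩ := Nat.exists_eq_add_of_le h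
      rw [Nat.add_sub_cancel_left]
      nlinarith
  have h3 : (m : ℝ) ^ 2 ≤ ((Δ : ℝ) + 1) ^ 2 + ((m - (Δ + 1) : ℕ) : ℝ) * (2 * threshold Δ) := by
    exact_mod_cast h2
  unfold queryBound
  linarith

/-- The clique of size `k` is repeated in every recursive call, so total size may grow; after
subtracting `D ≥ k` from each size it does not. -/
theorem sum_add_tsub_le {ι : Type} (s : Finset ι) (a : ι → ℕ) {k D : ℕ} (hk : k ≤ D) :
    ∑ i ∈ s, (a i + k - D) ≤ ∑ i ∈ s, a i + k - D := by
  classical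
  induction s using Finset.induction_on with
  | empty => simp
  | insert i s hi ih =>
    rw [Finset.sum_insert hi, Finset.sum_insert hi]
    omega

theorem le_two_mul_tsub {Δ m : ℕ} (hm : threshold Δ < m) :
    (m : ℝ) ≤ 2 * ((m - (Δ + 1) : ℕ) : ℝ) := by
  have h1 : 2 * (Δ + 1) ≤ m := by
    refine le_trans ?_ hm.le
    unfold threshold
    exact Nat.mul_le_mul (Nat.le_self_pow (by omega) 2) (Nat.le_self_pow two_ne_zero _)
  exact_mod_cast (by omega : m ≤ 2 * (m - (Δ + 1)))

theorem mul_le_queryBound {Δ m : ℕ} {q : ℝ} (hq : 0 ≤ q) (hΔ : 2 ≤ Δ) (hm : threshold Δ < m) :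
    q * m ≤ queryBound Δ q m := by
  have hlogm := one_le_log_of_threshold_lt hm
  have hΔ' : (1 : ℝ) ≤ Δ := by exact_mod_cast (by omega : 1 ≤ Δ)
  have hpow : (1 : ℝ) ≤ 2 ^ Δ := one_le_pow₀ (by norm_num)
  have h1 : 2 * q ≤ 24 * Δ * 2 ^ Δ * q * Real.log m :=
    calc 2 * q ≤ 24 * 1 * 1 * q * 1 := by linarith
      _ ≤ _ := by gcongr
  calc q * m ≤ q * (2 * ((m - (Δ + 1) : ℕ) : ℝ)) := by gcongr; exact le_two_mul_tsub hm
    _ = 0 + ((m - (Δ + 1) : ℕ) : ℝ) * (0 + 2 * q) := by ring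
    _ ≤ _ := by
        unfold queryBound
        gcongr
        · positivity
        · positivity

/-- Passing to the calls lowers the logarithm by at least `lam = 1/(12Δ2^Δ)`, which releases `2q (m
- (Δ+1)) ≥ q m`. This pays for the separator and for the constant `(Δ+1)²` of each of the at most
`m` calls, the second term in `hc`. -/
theorem queryBound_step {ι : Type} (s : Finset ι) (a : ι → ℕ) {Δ m k : ℕ} {q : ℝ} (hq : 0 ≤ q)
    (hΔ : 2 ≤ Δ) (hm : threshold Δ < m) (hk : k ≤ Δ + 1) (hsum : ∑ i ∈ s, a i + k = m)
    (hs : s.card ≤ m) (ha : ∀ i ∈ s, 0 < a i) (hbal : ∀ i ∈ s, (a i : ℝ) < balance Δ * m)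
    {c : ℝ} (hc : c + ((Δ : ℝ) + 1) ^ 2 * m ≤ q * m) :
    c + ∑ i ∈ s, queryBound Δ q (a i + k) ≤ queryBound Δ q m := by
  have hlogm := one_le_log_of_threshold_lt hm
  have hΔ' : (2 : ℝ) ≤ Δ := by exact_mod_cast hΔ
  set lam := 1 / (12 * (Δ : ℝ) * 2 ^ Δ) with hlam
  have hpow : (1 : ℝ) ≤ 2 ^ Δ := one_le_pow₀ (by norm_num)
  have hlam0 : 0 < lam := by positivity
  have hlam1 : lam ≤ 1 := by
    rw [hlam, div_le_one (by positivity)]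
    nlinarith
  have hmpos : (0 : ℝ) < m := by exact_mod_cast (Nat.zero_lt_of_lt hm)
  set B := 2 * (threshold Δ : ℝ) + 24 * Δ * 2 ^ Δ * q * (Real.log m - lam) with hB
  have hB0 : 0 ≤ B := by
    have : 0 ≤ Real.log m - lam := by linarith
    positivity
  have hterm : ∀ i ∈ s, queryBound Δ q (a i + k) ≤
      ((Δ : ℝ) + 1) ^ 2 + ((a i + k - (Δ + 1) : ℕ) : ℝ) * B := by
    intro i hi
    have h1 := card_add_le_of_balanced hΔ hm (hbal i hi) hk
    have hpos : (0 : ℝ) < ((a i + k : ℕ) : ℝ) := by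
      have := ha i hi
      exact_mod_cast (by omega : 0 < a i + k)
    have h2 : Real.log ((a i + k : ℕ) : ℝ) ≤ Real.log m - lam := by
      have hlt : 0 < 1 - lam := by
        by_contra hneg
        have := mul_nonpos_of_nonpos_of_nonneg (not_lt.1 hneg) hmpos.le
        linarith
      calc _ ≤ Real.log ((1 - lam) * m) := Real.log_le_log hpos h1
        _ = Real.log (1 - lam) + Real.log m := Real.log_mul hlt.ne' hmpos.ne'
        _ ≤ _ := by linarith [Real.log_le_sub_one_of_pos hlt]
    unfold queryBound
    rw [hB]
    gcongr
  have hsumB : ∑ i ∈ s, (((a i + k - (Δ + 1) : ℕ) : ℝ)) * B ≤ ((m - (Δ + 1) : ℕ) : ℝ) * B := by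
    rw [← Finset.sum_mul]
    refine mul_le_mul_of_nonneg_right ?_ hB0
    have := sum_add_tsub_le s a hk
    rw [hsum] at this
    exact_mod_cast this
  have hm2 := le_two_mul_tsub hm
  calc c + ∑ i ∈ s, queryBound Δ q (a i + k)
      ≤ c + ∑ i ∈ s, (((Δ : ℝ) + 1) ^ 2 + ((a i + k - (Δ + 1) : ℕ) : ℝ) * B) := by
        gcongr with i hi
        exact hterm i hi
    _ = c + s.card * ((Δ : ℝ) + 1) ^ 2 + ∑ i ∈ s, ((a i + k - (Δ + 1) : ℕ) : ℝ) * B := by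
        rw [Finset.sum_add_distrib, Finset.sum_const, nsmul_eq_mul, add_assoc]
    _ ≤ q * m + ((m - (Δ + 1) : ℕ) : ℝ) * B := by
        have : (s.card : ℝ) * ((Δ : ℝ) + 1) ^ 2 ≤ m * ((Δ : ℝ) + 1) ^ 2 := by
          gcongr
        linarith
    _ ≤ q * (2 * ((m - (Δ + 1) : ℕ) : ℝ)) + ((m - (Δ + 1) : ℕ) : ℝ) * B := by gcongr
    _ = ((m - (Δ + 1) : ℕ) : ℝ) * (2 * threshold Δ + 24 * Δ * 2 ^ Δ * q * Real.log m) := by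
        have : 24 * Δ * 2 ^ Δ * lam = 2 := by
          rw [hlam]; field_simp; norm_num
        rw [hB]
        linear_combination (-(((m - (Δ + 1) : ℕ) : ℝ) * q)) * this
    _ ≤ queryBound Δ q m := by
        unfold queryBound
        have : 0 ≤ ((Δ : ℝ) + 1) ^ 2 := sq_nonneg _
        linarith

end Arithmetic

/-! ### Correctness and cost of the recursion -/

section Recursion

theorem unionOver_spec {V ι β : Type} [DecidableEq β] {δ : V → V → ℕ}
    {f : ι → OracleProg V (Finset β)} {S : ι → Set β} {c : ι → ℝ≥0∞} (l : List ι)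
    (h : ∀ i ∈ l, Spec δ (f i) (fun A => (A : Set β) = S i) (c i)) :
    Spec δ (unionOver f l) (fun A => (A : Set β) = ⋃ i ∈ l, S i) (l.map c).sum := by
  induction l with
  | nil => exact (runs_pure _).spec (by simp) (by simp)
  | cons i l ih =>
    have h1 := (h i List.mem_cons_self).bind (k := fun A => unionOver f l >>= fun B =>
      Pure.pure (A ∪ B)) (P' := fun A => (A : Set β) = ⋃ j ∈ i :: l, S j)
      (c' := (l.map c).sum + 0) fun A hA =>
        (ih fun j hj => h j (List.mem_cons_of_mem _ hj)).bind fun B hB =>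
          (runs_pure _).spec (by
            rw [Finset.coe_union, hA, hB]
            ext x
            simp) (by simp)
    rw [add_zero] at h1
    rw [List.map_cons, List.sum_cons]
    exact h1

variable {V : Type} [DecidableEq V]

/-- The edges of a graph with both ends in `U`. -/
def edgesIn (G : SimpleGraph V) (U : Finset V) : Set (Sym2 V) :=
  {e | e ∈ G.edgeSet ∧ ∀ v ∈ e, v ∈ U}

variable {G : SimpleGraph V}

/-- No edge joins two parts. Edges inside `K` lie in every `P ∪ K`; the hypothesis `hlt` ensures
that there is at least one part to carry them. -/
theorem iUnion_edgesIn_parts (hc : G.Connected) {U K : Finset V} (hU : GeodClosed G U)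
    (hKU : K ⊆ U) (hK : K.Nonempty) (hlt : K.card < U.card) :
    ⋃ P ∈ (parts G U K).toList, edgesIn G (P ∪ K) = edgesIn G U := by
  ext e
  simp only [Set.mem_iUnion, Finset.mem_toList, exists_prop]
  constructor
  · rintro ⟨P, hP, he, heP⟩
    exact ⟨he, fun v hv => Finset.union_subset
      ((parts_spec hc hU hP).2.1.trans Finset.sdiff_subset) hKU (heP v hv)⟩
  · rintro ⟨he, heU⟩
    have key : ∀ x ∈ U, ∀ y ∈ U, x ∉ K → G.Adj x y →
        ∃ P ∈ parts G U K, x ∈ P ∪ K ∧ y ∈ P ∪ K := by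
      intro x hx y hy hxK hxy
      obtain ⟨P, hP, hxP⟩ := exists_mem_parts hc hU hKU hK (Finset.mem_sdiff.2 ⟨hx, hxK⟩)
      exact ⟨P, hP, Finset.mem_union_left _ hxP,
        Finset.mem_union.2 (mem_parts_of_adj hc hU hKU hK hP hxP hy hxy)⟩
    induction e using Sym2.ind with
    | _ x y =>
      rw [SimpleGraph.mem_edgeSet] at he
      obtain ⟨P, hP, hx, hy⟩ : ∃ P ∈ parts G U K, x ∈ P ∪ K ∧ y ∈ P ∪ K := by
        have hxU := heU x (Sym2.mem_mk_left _ _)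
        have hyU := heU y (Sym2.mem_mk_right _ _)
        by_cases hx : x ∈ K
        · by_cases hy : y ∈ K
          · obtain ⟨z, hzU, hzK⟩ := Finset.exists_mem_notMem_of_card_lt_card hlt
            obtain ⟨P, hP, -⟩ := exists_mem_parts hc hU hKU hK (Finset.mem_sdiff.2 ⟨hzU, hzK⟩)
            exact ⟨P, hP, Finset.mem_union_right _ hx, Finset.mem_union_right _ hy⟩
          · obtain ⟨P, hP, h1, h2⟩ := key y hyU x hxU hy he.symm
            exact ⟨P, hP, h2, h1⟩
        · exact key x hxU y hyU hx he
      refine ⟨P, hP, he, fun v hv => ?_⟩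
      rcases Sym2.mem_iff.1 hv with rfl | rfl
      · exact hx
      · exact hy

theorem runs_reconstructChordal_small {Δ : ℕ} {U : Finset V} (h : ¬ threshold Δ < U.card) :
    ∃ E, Runs G.dist (reconstructChordal Δ U) E (U.card ^ 2) ∧
      (E : Set (Sym2 V)) = edgesIn G U := by
  obtain ⟨d, hd, hd'⟩ := runs_querySets G.dist U U
  refine ⟨((U ×ˢ U).filter fun p => d p.1 p.2 = 1).image fun p => s(p.1, p.2), ?_, ?_⟩
  · rw [reconstructChordal, dif_neg h, sq]
    exact hd.bind (r := 0) (runs_pure _)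
  · ext e
    induction e using Sym2.ind with
    | _ x y =>
      simp only [Finset.coe_image, Set.mem_image, Finset.mem_coe, Finset.mem_filter,
        Finset.mem_product, Prod.exists, edgesIn, Set.mem_ofPred_eq, SimpleGraph.mem_edgeSet]
      constructor
      · rintro ⟨a, b, ⟨⟨ha, hb⟩, hab⟩, hxy⟩
        rw [hd' a ha b hb, SimpleGraph.dist_eq_one_iff_adj] at hab
        rw [← hxy, ← SimpleGraph.mem_edgeSet, ← hxy]
        refine ⟨hab, fun v hv => ?_⟩
        rcases Sym2.mem_iff.1 hv with rfl | rfl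
        · exact ha
        · exact hb
      · rintro ⟨hadj, hmem⟩
        have hx := hmem x (Sym2.mem_mk_left _ _)
        have hy := hmem y (Sym2.mem_mk_right _ _)
        exact ⟨x, y, ⟨⟨hx, hy⟩, by rw [hd' x hx y hy, SimpleGraph.dist_eq_one_iff_adj]; exact hadj⟩,
          rfl⟩

/-- The factor `q` in `queryBound` for graphs with `n` vertices. -/
noncomputable def separatorFactor (Δ n : ℕ) : ℝ :=
  4112 * ((Δ : ℝ) + 1) ^ 2 * (2 ^ Δ + Real.log n ^ 2)

theorem separatorFactor_nonneg (Δ n : ℕ) : 0 ≤ separatorFactor Δ n := by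
  unfold separatorFactor
  positivity

theorem reconstructChordal_spec [Fintype V] [DecidableRel G.Adj] (hc : G.Connected)
    (hG : G.IsChordal) (hΔ : threshold G.maxDegree < Fintype.card V → 2 ≤ G.maxDegree)
    (U : Finset V) (hU : GeodClosed G U) :
    Spec G.dist (reconstructChordal G.maxDegree U) (fun E => (E : Set (Sym2 V)) = edgesIn G U)
      (ENNReal.ofReal (queryBound G.maxDegree
        (separatorFactor G.maxDegree (Fintype.card V)) U.card)) := by
  set Δ := G.maxDegree with hΔdef
  set q := separatorFactor Δ (Fintype.card V) with hq
  have hq0 : 0 ≤ q := separatorFactor_nonneg _ _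
  induction hn : U.card using Nat.strong_induction_on generalizing U with
  | _ n ih =>
  by_cases h : threshold Δ < U.card
  · have hUV : U.card ≤ Fintype.card V := Finset.card_le_univ U
    replace hΔ := hΔ (h.trans_le hUV)
    have hth : Δ + 1 ≤ threshold Δ := by
      unfold threshold
      calc Δ + 1 ≤ (Δ + 1) ^ 2 := Nat.le_self_pow two_ne_zero _
        _ ≤ _ := Nat.le_mul_of_pos_left _ (by positivity)
    have hne : U.Nonempty := Finset.card_pos.1 (Nat.zero_lt_of_lt h)
    obtain ⟨hround, hfail⟩ := separatorRound_spec hc hG hU hne (by omega)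
    have hsep : Spec G.dist (balancedSeparator Δ U hne) (BalancedClique G Δ U) _ :=
      hround.repeatUntil hfail
    rw [reconstructChordal, dif_pos h]
    set c₁ : ℕ := numSamples Δ U * (2 * U.card * Nat.clog 2 U.card + 2 * U.card) +
        (U.card + (Δ + 1) ^ 2 + 2 ^ (Δ + 1) * (2 * (Δ + 1) ^ 2 * U.card)) with hc₁
    set c₂ : ℕ := 2 * (Δ + 1) ^ 2 * U.card with hc₂
    have hcost : 2 * (c₁ : ℝ) + (c₂ : ℝ) + ((Δ + 1) ^ 2 * U.card : ℕ) ≤ q * U.card :=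
      separator_cost_le h hUV
    have hbound : ENNReal.ofReal (2 * (c₁ : ℝ) + c₂) = 2 * (c₁ : ℝ≥0∞) + c₂ := by
      rw [ENNReal.ofReal_add (by positivity) (by positivity), ENNReal.ofReal_mul (by norm_num)]
      simp
    -- The continuation receives whatever the separator leaves of the budget; `mul_le_queryBound`
    -- shows that this truncated subtraction loses nothing.
    refine (hsep.bind (c' := ENNReal.ofReal (queryBound Δ q n) - 2 * (c₁ : ℝ≥0∞)) ?_).mono
      (fun _ h => h) (add_tsub_cancel_of_le ?_).le
    · intro K hK
      obtain ⟨hKU, hKne, hcl, hbal⟩ := hK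
      have hKcard : K.card ≤ Δ + 1 := card_clique_le hc hcl
      have hpsum := sum_card_parts hc hU hKU hKne
      -- This makes the size test in the program always succeed, so no part is skipped.
      have hlt : ∀ P ∈ parts G U K, (P ∪ K).card < U.card := by
        intro P hP
        have h1 := card_add_le_of_balanced hΔ h (hbal P hP) hKcard
        have h2 : ((P.card + K.card : ℕ) : ℝ) < U.card := by
          refine h1.trans_lt ?_
          have hm0 : (0 : ℝ) < U.card := by exact_mod_cast hne.card_pos
          have h3 : (0 : ℝ) < 1 / (12 * (Δ : ℝ) * 2 ^ Δ) := by
            have : (0 : ℝ) < Δ := by exact_mod_cast (by omega : 0 < Δ)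
            positivity
          nlinarith
        exact (Finset.card_union_le _ _).trans_lt (by exact_mod_cast h2)
      have hrec : ∀ P ∈ (parts G U K).toList,
          Spec G.dist (if (P ∪ K).card < U.card then reconstructChordal Δ (P ∪ K) else
            Pure.pure ∅) (fun E => (E : Set (Sym2 V)) = edgesIn G (P ∪ K))
            (ENNReal.ofReal (queryBound Δ q (P.card + K.card))) := by
        intro P hP
        rw [Finset.mem_toList] at hP
        rw [if_pos (hlt P hP)]
        have hdisj : (P ∪ K).card = P.card + K.card :=
          Finset.card_union_of_disjoint (Finset.disjoint_left.2 fun x hx =>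
            (Finset.mem_sdiff.1 ((parts_spec hc hU hP).2.1 hx)).2)
        rw [← hdisj]
        exact ih _ (hn ▸ hlt P hP) (P ∪ K) (geodClosed_parts_union hc hU hKU hKne hcl hP) rfl
      have hpart := (runs_partition (G := G) U K).spec (P := fun p => p = parts G U K) rfl
        (Nat.cast_le.2 (partition_cost_le hc U hcl))
      refine (hpart.bind (c' := ((parts G U K).toList.map fun P =>
        ENNReal.ofReal (queryBound Δ q (P.card + K.card))).sum) ?_).mono (fun _ h => h) ?_
      · rintro _ rfl
        exact (unionOver_spec _ hrec).mono
          (fun E hE => hE.trans (iUnion_edgesIn_parts hc hU hKU hKne (by omega))) le_rfl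
      · rw [Finset.sum_map_toList,
          ← ENNReal.ofReal_sum_of_nonneg fun P _ => queryBound_nonneg Δ hq0 _]
        refine ENNReal.le_sub_of_add_le_left (by finiteness) ?_
        rw [← add_assoc, ← hbound, ← ENNReal.ofReal_add (by positivity)
          (Finset.sum_nonneg fun P _ => queryBound_nonneg Δ hq0 _)]
        refine ENNReal.ofReal_le_ofReal ?_
        rw [← hn]
        refine queryBound_step (parts G U K) Finset.card hq0 hΔ h hKcard hpsum
          (card_parts_le hc hU hKU hKne) (fun P hP => (parts_spec hc hU hP).1.card_pos) hbal ?_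
        push_cast at hcost
        linarith
    · calc 2 * (c₁ : ℝ≥0∞) ≤ 2 * (c₁ : ℝ≥0∞) + c₂ := le_self_add
        _ = ENNReal.ofReal (2 * (c₁ : ℝ) + c₂) := hbound.symm
        _ ≤ _ := by
          refine ENNReal.ofReal_le_ofReal ?_
          rw [← hn]
          refine le_trans ?_ (mul_le_queryBound hq0 hΔ h)
          push_cast at hcost
          have : 0 ≤ ((Δ : ℝ) + 1) ^ 2 * U.card := by positivity
          linarith
  · obtain ⟨E, hE, hE'⟩ := runs_reconstructChordal_small (G := G) h
    refine hE.spec hE' ?_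
    rw [← hn, ← ENNReal.ofReal_natCast]
    refine ENNReal.ofReal_le_ofReal ?_
    push_cast
    exact sq_le_queryBound hq0 (not_lt.1 h)

end Recursion

/-! ### From the potential to the stated bounds -/

/-- The leading coefficient is `24 · 4112 · 4 = 394752`. The lower-order terms add 36 to it, because
`(2^Δ + log² n) log n ≥ 1`. -/
theorem queryBound_le {Δ n : ℕ} (hΔ : 1 ≤ Δ) (hn : 2 ≤ n) :
    queryBound Δ (separatorFactor Δ n) n ≤
      400000 * ((Δ : ℝ) ^ 3 * 2 ^ Δ * n * (2 ^ Δ + Real.log n ^ 2) * Real.log n) := by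
  have hΔ' : (1 : ℝ) ≤ Δ := by exact_mod_cast hΔ
  have hn' : (2 : ℝ) ≤ n := by exact_mod_cast hn
  have hL : 1 / 2 ≤ Real.log n := by
    have := Real.log_le_log (by norm_num) hn'
    linarith [Real.log_two_gt_d9]
  have hp : (2 : ℝ) ≤ 2 ^ Δ := by
    calc (2 : ℝ) = 2 ^ 1 := (pow_one _).symm
      _ ≤ _ := pow_le_pow_right₀ (by norm_num) hΔ
  have hD : ((Δ : ℝ) + 1) ^ 2 ≤ 4 * Δ ^ 2 := by nlinarith
  have hth : (threshold Δ : ℝ) ≤ 16 * 2 ^ Δ * Δ ^ 2 := by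
    unfold threshold
    push_cast
    rw [pow_add]
    nlinarith
  unfold queryBound separatorFactor
  set L := Real.log n
  set p := (2 : ℝ) ^ Δ
  set Δ' := (Δ : ℝ)
  have hS : 1 ≤ (p + L ^ 2) * L := by nlinarith [sq_nonneg L]
  have hS0 : 0 < (p + L ^ 2) * L := by linarith
  have h1 : ((n - (Δ + 1) : ℕ) : ℝ) ≤ n := by exact_mod_cast Nat.sub_le _ _
  have h23 : Δ' ^ 2 ≤ Δ' ^ 3 := pow_le_pow_right₀ hΔ' (by norm_num)
  have hmain : Δ' ^ 2 * p * n ≤ Δ' ^ 3 * p * n * ((p + L ^ 2) * L) := by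
    calc Δ' ^ 2 * p * n = Δ' ^ 2 * p * n * 1 := (mul_one _).symm
      _ ≤ _ := by gcongr
  calc (Δ' + 1) ^ 2 + ((n - (Δ + 1) : ℕ) : ℝ) * (2 * threshold Δ +
        24 * Δ' * p * (4112 * (Δ' + 1) ^ 2 * (p + L ^ 2)) * L)
      ≤ 4 * Δ' ^ 2 + n * (2 * (16 * p * Δ' ^ 2) +
        24 * Δ' * p * (4112 * (4 * Δ' ^ 2) * (p + L ^ 2)) * L) := by gcongr
    _ = 4 * Δ' ^ 2 + 32 * (Δ' ^ 2 * p * n) +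
        394752 * (Δ' ^ 3 * p * n * ((p + L ^ 2) * L)) := by ring
    _ ≤ 4 * (Δ' ^ 2 * p * n) + 32 * (Δ' ^ 2 * p * n) +
        394752 * (Δ' ^ 3 * p * n * ((p + L ^ 2) * L)) := by
        gcongr
        have : 1 ≤ p * n := by nlinarith
        nlinarith [sq_nonneg Δ']
    _ ≤ 400000 * (Δ' ^ 3 * p * n * ((p + L ^ 2) * L)) := by
        have : 0 ≤ Δ' ^ 3 * p * n * ((p + L ^ 2) * L) := by positivity
        linarith
    _ = _ := by ring

/-- A connected graph has at least `n - 1` edges, so its degree sum is at least `2n - 2`, which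
exceeds `n` when `n > 2`. -/
theorem two_le_maxDegree {V : Type} [Fintype V] [DecidableEq V] {G : SimpleGraph V}
    [DecidableRel G.Adj] (hc : G.Connected) (hV : 2 < Fintype.card V) : 2 ≤ G.maxDegree := by
  have h1 := hc.card_vert_le_card_edgeSet_add_one
  have h2 := G.sum_degrees_eq_twice_card_edges
  have h3 : ∑ v, G.degree v ≤ Fintype.card V * G.maxDegree := by
    simpa using Finset.sum_le_card_nsmul Finset.univ _ _ fun v _ => G.degree_le_maxDegree v
  rw [Nat.card_eq_fintype_card, Nat.card_eq_fintype_card, ← SimpleGraph.edgeFinset_card] at h1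
  by_contra h
  have h4 : Fintype.card V * G.maxDegree ≤ Fintype.card V * 1 := Nat.mul_le_mul_left _ (by omega)
  omega

theorem reconstructChordal_univ_spec {V : Type} [Fintype V] [DecidableEq V] (G : SimpleGraph V)
    [DecidableRel G.Adj] (hV : 2 ≤ Fintype.card V) (hc : G.Connected) (hG : G.IsChordal) :
    Spec G.dist (reconstructChordal G.maxDegree Finset.univ)
      (fun E => (E : Set (Sym2 V)) = G.edgeSet)
      (ENNReal.ofReal (400000 * ((G.maxDegree : ℝ) ^ 3 * 2 ^ G.maxDegree * Fintype.card V *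
        (2 ^ G.maxDegree + Real.log (Fintype.card V) ^ 2) * Real.log (Fintype.card V)))) := by
  have hΔ : 1 ≤ G.maxDegree := by
    have : Nontrivial V := Fintype.one_lt_card_iff_nontrivial.1 hV
    obtain ⟨v⟩ := hc.nonempty
    exact (hc.preconnected.degree_pos_of_nontrivial v).trans_le (G.degree_le_maxDegree v)
  refine (reconstructChordal_spec hc hG (fun h => two_le_maxDegree hc ?_) Finset.univ
    fun _ _ _ _ _ _ => Finset.mem_univ _).mono ?_ ?_
  · refine lt_of_le_of_lt ?_ h
    unfold threshold
    exact le_trans (Nat.le_self_pow (by omega) 2) (Nat.le_mul_of_pos_right _ (by positivity))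
  · rintro E hE
    rw [hE]
    simp [edgesIn]
  · exact ENNReal.ofReal_le_ofReal (queryBound_le hΔ hV)

/-- If the maximum degree is `O(log log n)`, then the bound is `n` times a power of `log n`. -/
theorem polylog_bound {c : ℝ} {Δ n : ℕ} (hΔ : 1 ≤ Δ) (hn : 3 ≤ n)
    (h : (Δ : ℝ) ≤ c * Real.log (Real.log n)) :
    (Δ : ℝ) ^ 3 * 2 ^ Δ * n * (2 ^ Δ + Real.log n ^ 2) * Real.log n ≤
      2 * (n * Real.log n ^ (5 * ⌈c⌉₊ + 3)) := by
  have hn' : (3 : ℝ) ≤ n := by exact_mod_cast hn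
  have hL : 1 < Real.log n := by
    rw [Real.lt_log_iff_exp_lt (by linarith)]
    linarith [Real.exp_one_lt_d9]
  set L := Real.log n
  have hLL : 0 < Real.log L := Real.log_pos hL
  -- Exponentiating the hypothesis bounds both `Δ` and `2^Δ` by `y = L ^ ⌈c⌉₊`; the bound contains
  -- five such factors. That `log log n > 0` allows rounding `c` up.
  have hexp : Real.exp Δ ≤ L ^ ⌈c⌉₊ := by
    rw [← Real.exp_log (show 0 < L ^ ⌈c⌉₊ by positivity), Real.log_pow]
    exact Real.exp_le_exp.2 (h.trans (mul_le_mul_of_nonneg_right (Nat.le_ceil c) hLL.le))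
  set y := L ^ ⌈c⌉₊ with hy
  have h1 : (Δ : ℝ) ≤ y := by linarith [Real.add_one_le_exp (Δ : ℝ)]
  have h2 : (2 : ℝ) ^ Δ ≤ y := by
    refine le_trans ?_ hexp
    rw [← mul_one (Δ : ℝ), Real.exp_nat_mul]
    gcongr
    linarith [Real.add_one_le_exp (1 : ℝ)]
  have hy1 : 1 ≤ y := one_le_pow₀ hL.le
  have h3 : (2 : ℝ) ^ Δ + L ^ 2 ≤ 2 * (y * L ^ 2) := by
    have hL2 : 1 ≤ L ^ 2 := one_le_pow₀ hL.le
    nlinarith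
  calc (Δ : ℝ) ^ 3 * 2 ^ Δ * n * (2 ^ Δ + L ^ 2) * L
      ≤ y ^ 3 * y * n * (2 * (y * L ^ 2)) * L := by gcongr
    _ = 2 * (n * (y ^ 5 * L ^ 3)) := by ring
    _ = 2 * (n * L ^ (5 * ⌈c⌉₊ + 3)) := by
        rw [hy, ← pow_mul, ← pow_add, mul_comm ⌈c⌉₊ 5]

end ChordalReconstruction

theorem theorem4 :
    (∃ C : ℝ, 0 < C ∧
      ∀ (V : Type) [Fintype V] [DecidableEq V] (G : SimpleGraph V) [DecidableRel G.Adj] (n Δ : ℕ),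
        Fintype.card V = n → 2 ≤ n → G.Connected → G.IsChordal → G.maxDegree = Δ →
          OracleProg.probability G.dist (ChordalReconstruction.reconstructChordal Δ Finset.univ)
              (fun E => (E : Set (Sym2 V)) = G.edgeSet) = 1 ∧
          OracleProg.expectedQueries G.dist
              (ChordalReconstruction.reconstructChordal Δ (Finset.univ : Finset V)) ≤
            ENNReal.ofReal (C * ((Δ : ℝ) ^ 3 * 2 ^ Δ * n * (2 ^ Δ + Real.log n ^ 2) * Real.log n))) ∧
    (∀ c : ℝ, ∃ (C : ℝ) (k : ℕ), 0 < C ∧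
      ∀ (V : Type) [Fintype V] [DecidableEq V] (G : SimpleGraph V) [DecidableRel G.Adj] (n Δ : ℕ),
        Fintype.card V = n → 2 ≤ n → G.Connected → G.IsChordal → G.maxDegree = Δ →
          (Δ : ℝ) ≤ c * Real.log (Real.log n) →
          OracleProg.expectedQueries G.dist
              (ChordalReconstruction.reconstructChordal Δ (Finset.univ : Finset V)) ≤
            ENNReal.ofReal (C * (n * Real.log n ^ k))) := by
  refine ⟨⟨400000, by norm_num, ?_⟩, fun c => ?_⟩
  · rintro V _ _ G _ n Δ rfl hn hc hG rfl
    have h := ChordalReconstruction.reconstructChordal_univ_spec G hn hc hG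
    exact ⟨h.probability_eq_one, h.cost⟩
  · have hlog2 : 0 < Real.log 2 := Real.log_pos one_lt_two
    -- The first summand handles `n ≥ 3`. For `n = 2`, where `log n < 1`, the second cancels the
    -- power of `log 2` and contributes `4800000 = 400000 · 12`, a bound for that single case.
    refine ⟨800000 + 2400000 / Real.log 2 ^ (5 * ⌈c⌉₊ + 3), 5 * ⌈c⌉₊ + 3, by positivity, ?_⟩
    rintro V _ _ G _ n Δ rfl hn hc hG rfl hle
    refine (ChordalReconstruction.reconstructChordal_univ_spec G hn hc hG).cost.trans (ENNReal.ofReal_le_ofReal ?_)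
    have hlogn : 0 ≤ Real.log (Fintype.card V) := Real.log_natCast_nonneg _
    rw [add_mul]
    rcases Nat.lt_or_ge 2 (Fintype.card V) with h3 | h2
    · have hΔ := ChordalReconstruction.two_le_maxDegree hc h3
      have := ChordalReconstruction.polylog_bound (by omega) h3 hle
      have h0 : 0 ≤ 2400000 / Real.log 2 ^ (5 * ⌈c⌉₊ + 3) *
          (Fintype.card V * Real.log (Fintype.card V) ^ (5 * ⌈c⌉₊ + 3)) := by positivity
      linarith
    · have hV : Fintype.card V = 2 := le_antisymm h2 hn
      have : Nonempty V := hc.nonempty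
      have hΔ : G.maxDegree ≤ 1 := by
        have := G.maxDegree_lt_card_verts
        omega
      rw [hV]
      have hΔ3 : (G.maxDegree : ℝ) ^ 3 ≤ 1 := pow_le_one₀ (by positivity) (by exact_mod_cast hΔ)
      have hΔ2 : (2 : ℝ) ^ G.maxDegree ≤ 2 :=
        (pow_le_pow_right₀ (by norm_num) hΔ).trans_eq (pow_one 2)
      have hl1 : Real.log 2 ≤ 1 := by linarith [Real.log_two_lt_d9]
      have h1 : 2400000 / Real.log 2 ^ (5 * ⌈c⌉₊ + 3) *
          (((2 : ℕ) : ℝ) * Real.log ((2 : ℕ) : ℝ) ^ (5 * ⌈c⌉₊ + 3)) = 4800000 := by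
        push_cast
        field_simp
        norm_num
      have h0 : 0 ≤ 800000 * (((2 : ℕ) : ℝ) * Real.log ((2 : ℕ) : ℝ) ^ (5 * ⌈c⌉₊ + 3)) := by
        positivity
      rw [h1]
      push_cast at h0 ⊢
      calc 400000 * ((G.maxDegree : ℝ) ^ 3 * 2 ^ G.maxDegree * 2 *
            (2 ^ G.maxDegree + Real.log 2 ^ 2) * Real.log 2)
          ≤ 400000 * (1 * 2 * 2 * (2 + 1 ^ 2) * 1) := by gcongr
        _ ≤ _ := by linarith
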